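/- **Proposition 2.4.** Let $E\subset\mathbf R^2$ be a closed region bounded by an ellipse with any centre, any directions of the axes and any semi-axes $p,q>0$ (discs included), and let $D=\mathbf R^2\setminus E$ be its exterior. Then $\Lambda(D)$ is well defined and $$\Lambda(D)=\int_{\partial D}\nu(x)\,dx+\int_{\partial D}\int_{\partial D}|\log\cos\alpha(x,y)|\,\omega_x(dy)\,dx=0 .$$ Here: * $dx$ is arc length on $\partial D$ and $\mathbf n(x)$ is the unit normal at $x\in\partial D$ pointing into $D$. * $\nu(x)$ is the curvature of $\partial D$ at $x$: in the orthonormal coordinates in which $x=(0,0)$ and $\mathbf n(x)=(0,1)$, $\partial D$ is near $x$ the graph of a $C^4$ function $y_2=\tfrac12\nu(x)y_1^2+O(y_1^3)$, with $D$ above the graph. * $\alpha(x,y)\in[0,\pi/2]$ is the angle between the tangent lines to $\partial D$ at $x$ and $y$. * $\omega_x(dy)=a_x\,\dfrac{\partial K(x,y)}{\partial\mathbf n(y)}\,dy$, where $K(x,\cdot)$ is a Martin kernel of $D$ with pole at $x$, i.e. a positive harmonic function in $D$, bounded near infinity, which tends to $0$ at every point of $\partial D\setminus\{x\}$, and the constant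 $a_x$ is such that $\pi|x-y|^2\,\omega_x(dy)/dy\to1$ as $y\to x$ along $\partial D$. "Well defined" means that $\mathbf n(x)$, $\nu(x)$ and the density $\omega_x(dy)/dy$ on $\partial D\setminus\{x\}$ exist and are unique for every $x\in\partial D$, that $\cos\alpha(x,y)\neq0$ for almost every $y$, for each $x\in\partial D$, and that $\nu$, the inner integrand (for each $x\in\partial D$) and the inner integral (as a function of $x$) are integrable with respect to arc length. -/

import Mathlib

open MeasureTheory Filter Topology Asymptotics InnerProductSpace

noncomputable section

/-- In the orthonormal system centred at `x` with axes `-i n` and `n`, and inside a small box, the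
set `D` is the region strictly above the graph of the `C^4` function `ψ`, and the graph is tangent
to the first axis at the origin. So near `x` the boundary of `D` is the graph of `ψ`, and `n` is
the unit normal at `x` which points into `D`. -/
structure IsBoundaryChart (D : Set ℂ) (x n : ℂ) (ψ : ℝ → ℝ) : Prop where
  norm_eq : ‖n‖ = 1
  contDiffAt : ContDiffAt ℝ 4 ψ 0
  map_zero : ψ 0 = 0
  deriv_zero : deriv ψ 0 = 0
  mem_iff : ∃ r : ℝ, 0 < r ∧ ∀ s t : ℝ, |s| < r → |t| < r →
    (x + ((s : ℂ) * (-Complex.I * n) + (t : ℂ) * n) ∈ D ↔ ψ s < t)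

/-- `n` is the unit inward normal of `D` at the boundary point `x`. -/
def IsInwardNormal (D : Set ℂ) (x n : ℂ) : Prop :=
  ∃ ψ : ℝ → ℝ, IsBoundaryChart D x n ψ

/-- `κ` is the curvature of the boundary of `D` at `x`, with respect to the inward normal:
the boundary is locally the graph of a function `ψ s = κ s ^ 2 / 2 + O(s ^ 3)`. -/
def IsBoundaryCurvature (D : Set ℂ) (x : ℂ) (κ : ℝ) : Prop :=
  ∃ (n : ℂ) (ψ : ℝ → ℝ), IsBoundaryChart D x n ψ ∧
    (fun s : ℝ => ψ s - (1 / 2) * κ * s ^ 2) =O[𝓝 0] (fun s : ℝ => s ^ 3)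

/-- The unit inward normal `n(x)`. -/
def inwardNormal (D : Set ℂ) (x : ℂ) : ℂ :=
  Classical.epsilon (IsInwardNormal D x)

/-- The curvature `ν(x)` of the boundary. -/
def boundaryCurvature (D : Set ℂ) (x : ℂ) : ℝ :=
  Classical.epsilon (IsBoundaryCurvature D x)

/-- The angle in `[0, π / 2]` formed by the tangent lines to the boundary of `D` at `x` and `y`;
these lines have the directions `i n(x)` and `i n(y)`. -/
def tangentAngle (D : Set ℂ) (x y : ℂ) : ℝ :=
  Real.arccos |inner ℝ (Complex.I * inwardNormal D x) (Complex.I * inwardNormal D y)|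

/-- Arc length on the boundary of `D`: one-dimensional Hausdorff measure. -/
def arcLength (D : Set ℂ) : Measure ℂ :=
  (Measure.hausdorffMeasure 1 : Measure ℂ).restrict (frontier D)

/-- `K` is a Martin kernel of `D` with pole at the boundary point `x`: a positive harmonic function
in `D` which vanishes on the boundary except at `x`. If `D` is unbounded, the point at infinity is
not a pole either, that is, `K` is bounded near infinity. Only the values of `K` in `D` matter. -/
structure IsMartinKernel (D : Set ℂ) (x : ℂ) (K : ℂ → ℝ) : Prop where
  harmonic : HarmonicOnNhd K D
  pos : ∀ y ∈ D, 0 < K y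
  vanish : ∀ z ∈ frontier D, z ≠ x → Tendsto K (𝓝[D] z) (𝓝 0)
  bounded_at_infinity : ∃ R C : ℝ, ∀ y ∈ D, R ≤ ‖y‖ → K y ≤ C

/-- `d` is the derivative along the inward normal, at the boundary point `y`, of a function `K` on
`D` whose boundary value at `y` is `0`. -/
def HasInwardNormalDeriv (D : Set ℂ) (K : ℂ → ℝ) (y : ℂ) (d : ℝ) : Prop :=
  Tendsto (fun h : ℝ => K (y + (h : ℂ) * inwardNormal D y) / h) (𝓝[>] 0) (𝓝 d)

/-- `k` is the density with respect to arc length of the "harmonic measure" `ω_x` with base point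
`x` on the boundary: `k y = a * ∂K(x, y) / ∂n(y)`, where the constant `a` is such that
`π * dist x y ^ 2 * k y → 1` as `y → x` along the boundary. -/
def IsHarmonicDensity (D : Set ℂ) (x : ℂ) (k : ℂ → ℝ) : Prop :=
  (∃ (K : ℂ → ℝ) (a : ℝ), IsMartinKernel D x K ∧
    ∀ y ∈ frontier D, y ≠ x → ∃ d : ℝ, HasInwardNormalDeriv D K y d ∧ k y = a * d) ∧
  Tendsto (fun y => Real.pi * dist x y ^ 2 * k y) (𝓝[frontier D \ {x}] x) (𝓝 1)

/-- The density `ω_x(dy) / dy`. -/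
def harmonicDensity (D : Set ℂ) (x : ℂ) : ℂ → ℝ :=
  Classical.epsilon (IsHarmonicDensity D x)

/-- The Lyapunov exponent
`Λ(D) = ∫ ν(x) dx + ∫ ∫ |log cos α(x, y)| ω_x(dy) dx` over the boundary of `D`. -/
def lyapunovExponent (D : Set ℂ) : ℝ :=
  (∫ x, boundaryCurvature D x ∂(arcLength D)) +
    ∫ x, (∫ y, |Real.log (Real.cos (tangentAngle D x y))| * harmonicDensity D x y ∂(arcLength D))
      ∂(arcLength D)

/-- All objects in the definition of `Λ(D)` exist and are unique, and the integrals are finite. -/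
structure LyapunovWellDefined (D : Set ℂ) : Prop where
  normal : ∀ x ∈ frontier D, ∃! n : ℂ, IsInwardNormal D x n
  curvature : ∀ x ∈ frontier D, ∃! κ : ℝ, IsBoundaryCurvature D x κ
  density_exists : ∀ x ∈ frontier D, ∃ k : ℂ → ℝ, IsHarmonicDensity D x k
  density_unique : ∀ x ∈ frontier D, ∀ k k' : ℂ → ℝ, IsHarmonicDensity D x k →
    IsHarmonicDensity D x k' → Set.EqOn k k' (frontier D \ {x})
  integrable_curvature : Integrable (boundaryCurvature D) (arcLength D)
  cos_ne_zero : ∀ x ∈ frontier D, ∀ᵐ y ∂(arcLength D), Real.cos (tangentAngle D x y) ≠ 0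
  integrable_inner : ∀ x ∈ frontier D, Integrable
    (fun y => |Real.log (Real.cos (tangentAngle D x y))| * harmonicDensity D x y) (arcLength D)
  integrable_outer : Integrable
    (fun x => ∫ y, |Real.log (Real.cos (tangentAngle D x y))| * harmonicDensity D x y
      ∂(arcLength D)) (arcLength D)

/-- The exterior of the ellipse with centre `c`, semi-axes `p` and `q`, and axes in the directions
`u` and `i u`, where `u` has modulus `1`. -/
def ellipseExterior (c u : ℂ) (p q : ℝ) : Set ℂ :=
  {z | 1 < (((z - c) * (starRingEnd ℂ) u).re / p) ^ 2 + (((z - c) * (starRingEnd ℂ) u).im / q) ^ 2}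

end

/-!
Write `A = (p + q) / 2` and `B = (p - q) / 2`. The map `w ↦ c + u (A / w + B w)` is conformal from
the punctured unit disc onto the exterior `D` of the ellipse, it extends to the circle, and it
sends `0` to infinity. Hence the Martin kernels of `D` are the multiples of the transported Poisson
kernels, and if `L(θ)` denotes the speed of the parametrization of the ellipse by the eccentric
angle `θ`, the harmonic measure with base point at the angle `φ` is `dθ / (4 π L(φ) sin² ((θ - φ) /
2))` (`Ellipse.isHarmonicDensity_density`, `Ellipse.eqOn_density`).

The theorem holds because the inner integral is equal to `-ν(x)` at every boundary point `x`
(`Ellipse.integral_inner`), so that the two terms of `Λ(D)` cancel. Let `x` have the eccentric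
angle `φ` and put `δ = θ - φ`. The tangent of the angle between the tangent lines is `k / (cot δ +
m)`, where `k = p q / L(φ)²` and `m` depends on `φ` only (`Ellipse.abs_log_cos_tangentAngle`). It
has the same value at the antipodal angle `δ + π`, and the weights `1 / (4 sin² (δ / 2))` of these
two angles add up to `1 / sin² δ`, so the substitution `v = cot δ` turns the inner integral into
`(2 π L(φ))⁻¹ ∫ log (1 + k² / (v + m)²) dv = k / L(φ) = p q / L(φ)³`
(`integral_Ioc_log_cot_div_sin_half_sq`), while the curvature is `-p q / L(φ)³`
(`Ellipse.exists_chart`).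

Uniqueness of the Martin kernel rests on two facts about harmonic functions. One that is bounded
near an isolated singularity extends across it (`HarmonicOnNhd.exists_extension_of_bounded`); this
applies at infinity. One that is nonnegative on the disc and vanishes on the circle except at one
point is a multiple of the Poisson kernel (`HarmonicOnNhd.eq_poissonKernel_mul`). The passage from
Hausdorff measure to the eccentric angle is the area formula for curves of class `C^1`
(`hausdorffMeasure_image_eq_lintegral_norm_deriv`).
-/

noncomputable section

/-! ### Removable singularities of harmonic functions -/

/-- The complex gradient `∂u/∂x - i ∂u/∂y` of a real function on the plane. For a harmonic function
it is holomorphic, and it is the derivative of every holomorphic function with real part `u`. -/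
def complexGradient (u : ℂ → ℝ) (z : ℂ) : ℂ :=
  fderiv ℝ u z 1 - Complex.I * fderiv ℝ u z Complex.I

lemma fderiv_eq_re_complexGradient_mul (u : ℂ → ℝ) (z v : ℂ) :
    fderiv ℝ u z v = (complexGradient u z * v).re := by
  have hv : v = v.re • (1 : ℂ) + v.im • Complex.I := by simp
  conv_lhs => rw [hv]
  rw [map_add, map_smul, map_smul]
  simp [complexGradient]
  ring

lemma hasFDerivAt_re_of_hasDerivAt {F : ℂ → ℂ} {F' z : ℂ} (hF : HasDerivAt F F' z) :
    HasFDerivAt (fun w => (F w).re)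
      (Complex.reCLM.comp (F' • (ContinuousLinearMap.id ℝ ℂ))) z := by
  have h := Complex.reCLM.hasFDerivAt.comp z (hF.complexToReal_fderiv)
  exact h

lemma complexGradient_re {F : ℂ → ℂ} {F' z : ℂ} (hF : HasDerivAt F F' z) :
    complexGradient (fun w => (F w).re) z = F' := by
  rw [complexGradient, (hasFDerivAt_re_of_hasDerivAt hF).fderiv]
  apply Complex.ext <;> simp

/-- A gradient estimate for bounded harmonic functions. The dependence on `M` is far from optimal,
but only the factor `1 / R` matters below. -/
lemma norm_complexGradient_le {u : ℂ → ℝ} {z : ℂ} {R M : ℝ} (hR : 0 < R)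
    (hu : HarmonicOnNhd u (Metric.ball z R)) (hM : ∀ y ∈ Metric.ball z R, |u y| ≤ M) :
    ‖complexGradient u z‖ ≤ 2 * Real.exp (2 * M) / R := by
  obtain ⟨F, hF, hFu⟩ := hu.exists_analyticOnNhd_ball_re_eq
  have hz : z ∈ Metric.ball z R := Metric.mem_ball_self hR
  have hd : HasDerivAt F (deriv F z) z := (hF z hz).differentiableAt.hasDerivAt
  have hgrad : complexGradient u z = deriv F z := by
    rw [← complexGradient_re hd]
    have : u =ᶠ[𝓝 z] fun w => (F w).re := by
      filter_upwards [Metric.ball_mem_nhds z hR] with w hw using (hFu hw).symm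
    simp only [complexGradient, this.fderiv_eq]
  have hsub : Metric.closedBall z (R / 2) ⊆ Metric.ball z R :=
    Metric.closedBall_subset_ball (by linarith)
  -- Cauchy's estimate for `exp F`, whose modulus `exp u` lies between `exp (-M)` and `exp M`
  have hC := Complex.norm_deriv_le_of_forall_mem_sphere_norm_le (f := fun w => Complex.exp (F w))
    (c := z) (R := R / 2) (C := Real.exp M) (by linarith)
    (DifferentiableOn.diffContOnCl (fun w hw => by
      rw [closure_ball _ (by linarith)] at hw
      exact ((hF w (hsub hw)).differentiableAt.cexp).differentiableWithinAt))
    (fun w hw => by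
      have hw' := hsub (Metric.sphere_subset_closedBall hw)
      rw [Complex.norm_exp]
      have h1 := hFu hw'
      have h2 := (abs_le.1 (hM w hw')).2
      simp only at h1
      rw [h1]
      exact Real.exp_le_exp.2 h2)
  rw [(hd.cexp).deriv, norm_mul, Complex.norm_exp, ← hgrad] at hC
  have h1 : (F z).re = u z := hFu hz
  have h2 := (abs_le.1 (hM z hz)).1
  rw [h1] at hC
  have h3 : Real.exp (-M) * ‖complexGradient u z‖ ≤ Real.exp M / (R / 2) :=
    le_trans (mul_le_mul_of_nonneg_right (Real.exp_le_exp.2 h2) (norm_nonneg _)) hC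
  have h4 : ‖complexGradient u z‖ = Real.exp M * (Real.exp (-M) * ‖complexGradient u z‖) := by
    rw [← mul_assoc, ← Real.exp_add]; simp
  rw [h4]
  calc _ ≤ Real.exp M * (Real.exp M / (R / 2)) := by gcongr
    _ = _ := by rw [show 2 * M = M + M by ring, Real.exp_add]; field_simp

/-- The complex gradient of a harmonic function which is bounded near the puncture of the disc has
at most a simple pole there. Here `c` is the residue and `Φ` a primitive of the regular part. -/
lemma exists_complexGradient_eq_of_bounded {u : ℂ → ℝ}
    (hu : HarmonicOnNhd u (Metric.ball 0 1 \ {0})) {δ M : ℝ} (hδ : 0 < δ) (hδ1 : δ ≤ 1)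
    (hM : ∀ z ∈ Metric.ball (0 : ℂ) δ \ {0}, |u z| ≤ M) :
    ∃ (c : ℂ) (Φ g : ℂ → ℂ), (∀ z ∈ Metric.ball (0 : ℂ) 1, HasDerivAt Φ (g z) z) ∧
      ∀ z ∈ Metric.ball (0 : ℂ) 1 \ {0}, complexGradient u z = c / z + g z := by
  set f : ℂ → ℂ := fun z => z * complexGradient u z with hf
  have hdiff : DifferentiableOn ℂ f (Metric.ball 0 1 \ {0}) := fun z hz =>
    (differentiableAt_id.mul
      (HarmonicAt.differentiableAt_complex_partial (hu z hz))).differentiableWithinAt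
  have hbd : ∀ᶠ z in 𝓝[≠] (0 : ℂ), ‖f z‖ ≤ 2 * Real.exp (2 * M) := by
    have : Metric.ball (0 : ℂ) (δ / 2) ∈ 𝓝 (0 : ℂ) := Metric.ball_mem_nhds _ (by linarith)
    filter_upwards [mem_nhdsWithin_of_mem_nhds this, self_mem_nhdsWithin] with z hz hz0
    have hz0' : z ≠ 0 := hz0
    have hzp : 0 < ‖z‖ := norm_pos_iff.2 hz0'
    rw [mem_ball_zero_iff] at hz
    have hsub : Metric.ball z ‖z‖ ⊆ Metric.ball (0 : ℂ) δ \ {0} := by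
      intro y hy
      rw [mem_ball_iff_norm] at hy
      refine ⟨?_, ?_⟩
      · rw [mem_ball_zero_iff]
        calc ‖y‖ = ‖(y - z) + z‖ := by ring_nf
          _ ≤ ‖y - z‖ + ‖z‖ := norm_add_le _ _
          _ < δ := by linarith
      · rintro rfl
        simp at hy
    have h := norm_complexGradient_le hzp
      (hu.mono (hsub.trans (Set.sdiff_subset_sdiff_left (Metric.ball_subset_ball hδ1))))
      (fun y hy => hM y (hsub hy))
    rw [hf, norm_mul]
    calc ‖z‖ * ‖complexGradient u z‖ ≤ ‖z‖ * (2 * Real.exp (2 * M) / ‖z‖) := by gcongr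
      _ = _ := by field_simp
  have hO : (fun z => f z - f 0) =o[𝓝[≠] (0 : ℂ)] fun z => (z - 0)⁻¹ := by
    apply IsBoundedUnder.isLittleO_sub_self_inv
    refine ⟨2 * Real.exp (2 * M) + ‖f 0‖, ?_⟩
    rw [eventually_map]
    filter_upwards [hbd] with z hz
    exact (norm_sub_le _ _).trans (by linarith)
  have hH := Complex.differentiableOn_update_limUnder_of_isLittleO
    (Metric.ball_mem_nhds (0 : ℂ) one_pos) hdiff hO
  set H := Function.update f 0 (limUnder (𝓝[≠] 0) f) with hHdef
  have hg : DifferentiableOn ℂ (dslope H 0) (Metric.ball 0 1) :=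
    (Complex.differentiableOn_dslope (Metric.ball_mem_nhds (0 : ℂ) one_pos)).2 hH
  obtain ⟨Φ, hΦ⟩ := hg.isExactOn_ball
  refine ⟨H 0, Φ, dslope H 0, hΦ, fun z hz => ?_⟩
  have hz0 : z ≠ 0 := hz.2
  rw [dslope_of_ne _ hz0, slope_def_field, sub_zero]
  have : H z = z * complexGradient u z := by rw [hHdef, Function.update_of_ne hz0]
  rw [this]
  field_simp
  ring

/-- A harmonic function on the punctured unit disc which is bounded near the puncture extends to a
harmonic function on the disc. The complex gradient has at most a simple pole; the boundedness and
the single-valuedness of the function leave no residue. -/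
theorem HarmonicOnNhd.exists_extension_of_bounded {u : ℂ → ℝ}
    (hu : HarmonicOnNhd u (Metric.ball 0 1 \ {0})) {δ M : ℝ} (hδ : 0 < δ) (hδ1 : δ ≤ 1)
    (hM : ∀ z ∈ Metric.ball (0 : ℂ) δ \ {0}, |u z| ≤ M) :
    ∃ U : ℂ → ℝ, HarmonicOnNhd U (Metric.ball 0 1) ∧ Set.EqOn U u (Metric.ball 0 1 \ {0}) := by
  obtain ⟨c, Φ, g, hΦ, hug⟩ := exists_complexGradient_eq_of_bounded hu hδ hδ1 hM
  set s : Set ℂ := {ζ | ζ.re < 0} with hs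
  have hso : IsOpen s := isOpen_lt Complex.continuous_re continuous_const
  have hsc : Convex ℝ s := convex_halfSpace_re_lt 0
  have hexp : ∀ ζ ∈ s, Complex.exp ζ ∈ Metric.ball (0 : ℂ) 1 \ {0} := by
    intro ζ hζ
    refine ⟨?_, Complex.exp_ne_zero _⟩
    rw [mem_ball_zero_iff, Complex.norm_exp]
    rw [← Real.exp_zero]
    exact Real.exp_lt_exp.2 hζ
  -- on the logarithmic cover, `u - Re Φ` is a real linear function
  set W : ℂ → ℝ := fun ζ => u (Complex.exp ζ) - (Φ (Complex.exp ζ)).re - (c * ζ).re with hW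
  have hWd : ∀ ζ ∈ s, HasFDerivAt W (0 : ℂ →L[ℝ] ℝ) ζ := by
    intro ζ hζ
    have he := hexp ζ hζ
    have h1 : HasFDerivAt u (fderiv ℝ u (Complex.exp ζ)) (Complex.exp ζ) :=
      ((hu _ he).1.differentiableAt two_ne_zero).hasFDerivAt
    have h2 := h1.comp ζ (Complex.hasDerivAt_exp ζ).complexToReal_fderiv
    have h3 := hasFDerivAt_re_of_hasDerivAt ((hΦ _ he.1).comp ζ (Complex.hasDerivAt_exp ζ))
    have h4 := hasFDerivAt_re_of_hasDerivAt ((hasDerivAt_id ζ).const_mul c)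
    have h5 := (h2.sub h3).sub h4
    refine h5.congr_fderiv ?_
    ext v
    · simp only [sub_apply, ContinuousLinearMap.comp_apply]
      rw [fderiv_eq_re_complexGradient_mul, hug _ he]
      have := Complex.exp_ne_zero ζ
      simp only [smul_apply, ContinuousLinearMap.id_apply, one_apply_eq_self, smul_eq_mul,
        Complex.reCLM_apply, zero_apply, ← Complex.sub_re]
      rw [show (c / Complex.exp ζ + g (Complex.exp ζ)) * (Complex.exp ζ * v)
        - g (Complex.exp ζ) * Complex.exp ζ * v - c * 1 * v = 0 by field_simp; ring]
      simp
  have hWc : ∀ x ∈ s, ∀ y ∈ s, W x = W y := fun x hx y hy =>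
    hso.is_const_of_fderiv_eq_zero (𝕜 := ℝ) hsc.isPreconnected
      (fun z hz => (hWd z hz).differentiableAt.differentiableWithinAt)
      (fun z hz => (hWd z hz).fderiv) hx hy
  set d := W (-1) with hd
  have hm1 : (-1 : ℂ) ∈ s := by simp [hs]
  have hWe : ∀ ζ ∈ s, u (Complex.exp ζ) = (Φ (Complex.exp ζ)).re + (c * ζ).re + d := by
    intro ζ hζ
    have := hWc ζ hζ (-1) hm1
    rw [← hd] at this
    simp only [hW] at this ⊢
    linarith
  -- the period `2πi` kills the imaginary part of the residue
  have him : c.im = 0 := by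
    have h2 : (-1 + 2 * Real.pi * Complex.I : ℂ) ∈ s := by simp [hs]
    have e1 := hWe _ hm1
    have e2 := hWe _ h2
    rw [Complex.exp_add, Complex.exp_two_pi_mul_I, mul_one] at e2
    rw [e1] at e2
    simp at e2
    have h3 : c.im * (2 * Real.pi) = 0 := by linarith
    simpa [Real.pi_ne_zero] using h3
  -- and boundedness near the puncture kills its real part
  have hre : c.re = 0 := by
    by_contra hne
    have hcont : ContinuousAt Φ 0 := (hΦ 0 (Metric.mem_ball_self one_pos)).continuousAt
    have hb1 : ∀ᶠ z in 𝓝 (0 : ℂ), ‖Φ z‖ ≤ ‖Φ 0‖ + 1 := by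
      filter_upwards [hcont.norm.eventually (gt_mem_nhds (lt_add_one ‖Φ 0‖))] with z hz using hz.le
    have hb2 : ∀ᶠ z in 𝓝 (0 : ℂ), z ∈ Metric.ball (0 : ℂ) δ := Metric.ball_mem_nhds _ hδ
    have ht : Tendsto (fun t : ℝ => Complex.exp t) atBot (𝓝 0) := by
      rw [tendsto_zero_iff_norm_tendsto_zero]
      simpa [Complex.norm_exp] using Real.tendsto_exp_atBot
    have hlin : Tendsto (fun t : ℝ => |c.re * t|) atBot atTop := by
      simp only [abs_mul]
      exact (tendsto_abs_atBot_atTop).const_mul_atTop (abs_pos.2 hne)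
    obtain ⟨t, h1, h2, h3, h4⟩ := ((ht.eventually hb1).and ((ht.eventually hb2).and
      ((eventually_lt_atBot (0 : ℝ)).and
      (hlin.eventually (eventually_gt_atTop (M + (‖Φ 0‖ + 1) + |d|)))))).exists
    have e := hWe t (by simpa [hs] using h3)
    have hre : (c * t).re = c.re * t := by simp
    have hMt := hM (Complex.exp t) ⟨h2, Complex.exp_ne_zero _⟩
    have hΦt := (Complex.abs_re_le_norm (Φ (Complex.exp t))).trans h1
    rw [hre] at e
    have e' : c.re * t = u (Complex.exp t) - (Φ (Complex.exp t)).re - d := by linarith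
    rw [e'] at h4
    have := abs_sub (u (Complex.exp t) - (Φ (Complex.exp t)).re) d
    have := abs_sub (u (Complex.exp t)) (Φ (Complex.exp t)).re
    linarith
  have hc : c = 0 := Complex.ext hre him
  refine ⟨fun z => (Φ z).re + d, fun z hz => ?_, fun z hz => ?_⟩
  · have hA : AnalyticAt ℂ Φ z := DifferentiableOn.analyticAt (s := Metric.ball 0 1)
      (fun y hy => (hΦ y hy).differentiableAt.differentiableWithinAt)
      (Metric.isOpen_ball.mem_nhds hz)
    have := (hA.add (analyticAt_const (v := (d : ℂ)))).harmonicAt_re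
    simpa using this
  · have hz0 : z ≠ 0 := hz.2
    have hlog : Complex.log z ∈ s := by
      simp only [hs, Set.mem_ofPred_eq, Complex.log_re]
      exact Real.log_neg (norm_pos_iff.2 hz0) (by simpa using hz.1)
    have := hWe _ hlog
    rw [Complex.exp_log hz0, hc] at this
    simp at this
    simp [this]

/-! ### Positive harmonic functions on the disc with one boundary singularity -/

/-- If a function on the unit disc tends to `0` at every point of the circle except `w₀`, then it is
uniformly small near the circle and away from `w₀`. -/
lemma exists_radius_forall_abs_le {U : ℂ → ℝ} {w₀ : ℂ}
    (hlim : ∀ ζ, ‖ζ‖ = 1 → ζ ≠ w₀ → Tendsto U (𝓝[Metric.ball 0 1] ζ) (𝓝 0))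
    {η ε : ℝ} (hη : 0 < η) (hε : 0 < ε) :
    ∃ ρ < 1, ∀ ζ ∈ Metric.ball (0 : ℂ) 1, ρ < ‖ζ‖ → η ≤ ‖ζ - w₀‖ → |U ζ| ≤ ε := by
  set V : Set ℂ := interior {ζ | ζ ∈ Metric.ball (0 : ℂ) 1 → |U ζ| ≤ ε} with hV
  have hcirc : ∀ ζ, ‖ζ‖ = 1 → ζ ≠ w₀ → ζ ∈ V := by
    intro ζ h1 h2
    rw [hV, mem_interior_iff_mem_nhds]
    have := (hlim ζ h1 h2).eventually (Metric.closedBall_mem_nhds (0 : ℝ) hε)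
    rw [eventually_nhdsWithin_iff] at this
    filter_upwards [this] with y hy hyb
    simpa using hy hyb
  set T : Set ℂ := Metric.closedBall 0 1 \ (Metric.ball w₀ η ∪ V) with hT
  have hTc : IsCompact T :=
    (isCompact_closedBall (0 : ℂ) 1).diff (Metric.isOpen_ball.union isOpen_interior)
  have hTlt : ∀ ζ ∈ T, ‖ζ‖ < 1 := by
    intro ζ hζ
    have h1 : ‖ζ‖ ≤ 1 := by simpa using hζ.1
    refine lt_of_le_of_ne h1 fun h => hζ.2 ?_
    by_cases h' : ζ = w₀
    · left; rw [h']; exact Metric.mem_ball_self hη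
    · right; exact hcirc ζ h h'
  obtain ⟨ρ, hρ, hTρ⟩ : ∃ ρ < 1, ∀ ζ ∈ T, ‖ζ‖ ≤ ρ := by
    rcases T.eq_empty_or_nonempty with h | h
    · exact ⟨0, one_pos, by simp [h]⟩
    · obtain ⟨m, hm, hmax⟩ := hTc.exists_isMaxOn h continuous_norm.continuousOn
      exact ⟨‖m‖, hTlt m hm, fun ζ hζ => hmax hζ⟩
  refine ⟨ρ, hρ, fun ζ hζ h1 h2 => ?_⟩
  by_contra hcon
  refine absurd (hTρ ζ ⟨Metric.ball_subset_closedBall hζ, ?_⟩) (not_le.2 h1)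
  rintro (h | h)
  · rw [mem_ball_iff_norm] at h; linarith
  · exact hcon (interior_subset h hζ)

/-- A nonnegative harmonic function on the unit disc whose boundary values vanish except at one
point `w₀` is a multiple of the Poisson kernel with pole at `w₀`. In the Poisson formula on the
circle of radius `r`, the measure `U(r e^{iθ}) dθ` has the constant mass `U 0`, and it concentrates
at `w₀` as `r → 1`. -/
theorem HarmonicOnNhd.eq_poissonKernel_mul {U : ℂ → ℝ} (hU : HarmonicOnNhd U (Metric.ball 0 1))
    (hpos : ∀ z ∈ Metric.ball (0 : ℂ) 1, 0 ≤ U z) {w₀ : ℂ} (hw₀ : ‖w₀‖ = 1)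
    (hlim : ∀ ζ, ‖ζ‖ = 1 → ζ ≠ w₀ → Tendsto U (𝓝[Metric.ball 0 1] ζ) (𝓝 0))
    {w : ℂ} (hw : w ∈ Metric.ball (0 : ℂ) 1) :
    U w = poissonKernel 0 w w₀ * U 0 := by
  have hw1 : ‖w‖ < 1 := by simpa using hw
  set p := poissonKernel 0 w with hp
  set a : ℝ := (1 + ‖w‖) / 2 with ha
  have ha1 : a < 1 := by rw [ha]; linarith
  have haw : ‖w‖ < a := by rw [ha]; linarith
  have hpc : ∀ ζ, ζ ≠ w → ContinuousAt p ζ := by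
    intro ζ hζ
    change ContinuousAt (fun z => (‖z - 0‖ ^ 2 - ‖w - 0‖ ^ 2) / ‖(z - 0) - (w - 0)‖ ^ 2) ζ
    apply ContinuousAt.div (by fun_prop) (by fun_prop)
    simp [sub_eq_zero, hζ]
  have hann : IsCompact (Metric.closedBall (0 : ℂ) 1 \ Metric.ball 0 a) :=
    (isCompact_closedBall (0 : ℂ) 1).diff Metric.isOpen_ball
  have hne : ∀ ζ : ℂ, a ≤ ‖ζ‖ → ζ ≠ w := by rintro ζ h rfl; linarith
  obtain ⟨C, hC⟩ := hann.exists_bound_of_continuousOn (f := fun ζ => p ζ - p w₀) (fun ζ hζ =>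
    ((hpc ζ (hne ζ (by simpa using hζ.2))).sub continuousAt_const).continuousWithinAt)
  have hC0 : 0 ≤ C := (norm_nonneg _).trans (hC w₀ ⟨by simp [hw₀], by simp [hw₀, ha1.le]⟩)
  have key : ∀ ε > 0, |U w - p w₀ * U 0| ≤ ε * (U 0 + C) := by
    intro ε hε
    have hcw := hpc w₀ (hne w₀ (by linarith))
    obtain ⟨η, hη, hηp⟩ := Metric.continuousAt_iff.1 hcw ε hε
    obtain ⟨ρ, hρ1, hρ⟩ := exists_radius_forall_abs_le hlim hη hε
    obtain ⟨r, hr1, hr2⟩ := exists_between (max_lt hρ1 ha1)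
    have hrρ : ρ < r := (le_max_left _ _).trans_lt hr1
    have hra : a < r := (le_max_right _ _).trans_lt hr1
    have hr0 : 0 < r := by linarith [norm_nonneg w]
    have hsub : Metric.closedBall (0 : ℂ) r ⊆ Metric.ball 0 1 :=
      Metric.closedBall_subset_ball hr2
    have hUr : HarmonicOnNhd U (Metric.closedBall 0 r) := hU.mono hsub
    have e1 := hUr.circleAverage_poissonKernel_smul (w := w) (by simpa using haw.trans hra)
    have e2 : Real.circleAverage U 0 r = U 0 :=
      InnerProductSpace.HarmonicOnNhd.circleAverage_eq (by rwa [abs_of_pos hr0])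
    have hUc : ContinuousOn U (Metric.sphere 0 |r|) := by
      rw [abs_of_pos hr0]
      exact fun ζ hζ => ((hUr ζ (Metric.sphere_subset_closedBall hζ)).1.continuousAt
        ).continuousWithinAt
    have hpcs : ContinuousOn p (Metric.sphere 0 |r|) := by
      rw [abs_of_pos hr0]
      intro ζ hζ
      refine (hpc ζ (hne ζ ?_)).continuousWithinAt
      rw [mem_sphere_zero_iff_norm] at hζ
      linarith
    have i1 : CircleIntegrable (p • U) 0 r := (hpcs.smul hUc).circleIntegrable'
    have i2 : CircleIntegrable U 0 r := hUc.circleIntegrable'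
    have i3 : CircleIntegrable (p w₀ • U) 0 r :=
      (hUc.const_smul (p w₀)).circleIntegrable'
    have i4 : CircleIntegrable (ε • U) 0 r :=
      (hUc.const_smul ε).circleIntegrable'
    have i5 : CircleIntegrable (fun _ : ℂ => ε * C) 0 r := continuousOn_const.circleIntegrable'
    have e3 : U w - p w₀ * U 0 = Real.circleAverage (p • U - p w₀ • U) 0 r := by
      rw [Real.circleAverage_sub i1 i3, Real.circleAverage_smul, e1, e2, smul_eq_mul]
    rw [e3]
    refine Real.abs_circleAverage_le_circleAverage_abs.trans ?_
    have e4 : Real.circleAverage (ε • U + fun _ => ε * C) 0 r = ε * (U 0 + C) := by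
      rw [Real.circleAverage_add i4 i5, Real.circleAverage_smul, e2, Real.circleAverage_const]
      simp only [smul_eq_mul]; ring
    rw [← e4]
    refine Real.circleAverage_mono (i1.sub i3).abs (i4.add i5) fun ζ hζ => ?_
    rw [abs_of_pos hr0, mem_sphere_zero_iff_norm] at hζ
    have hζb : ζ ∈ Metric.ball (0 : ℂ) 1 := by simp [hζ, hr2]
    have hUζ := hpos ζ hζb
    simp only [Pi.abs_apply, Pi.sub_apply, Pi.add_apply, Pi.smul_apply, Pi.mul_apply, smul_eq_mul]
    rw [← sub_mul, abs_mul]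
    rcases lt_or_ge ‖ζ - w₀‖ η with h | h
    · have h1 : |p ζ - p w₀| ≤ ε := by
        have := hηp (x := ζ) (by rwa [dist_eq_norm])
        rw [Real.dist_eq] at this
        exact this.le
      rw [abs_of_nonneg hUζ]
      have := mul_le_mul_of_nonneg_right h1 hUζ
      have := mul_nonneg hε.le hC0
      linarith
    · have h1 := hρ ζ hζb (by linarith) h
      have h2 := hC ζ ⟨by simp [hζ, hr2.le], by simp [hζ, hra.le]⟩
      rw [Real.norm_eq_abs] at h2
      calc |p ζ - p w₀| * |U ζ| ≤ C * ε := mul_le_mul h2 h1 (abs_nonneg _) hC0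
        _ ≤ _ := by nlinarith [mul_nonneg hε.le hUζ]
  have hlim0 : Tendsto (fun ε : ℝ => ε * (U 0 + C)) (𝓝[>] 0) (𝓝 0) := by
    have : Tendsto (fun ε : ℝ => ε * (U 0 + C)) (𝓝 0) (𝓝 (0 * (U 0 + C))) :=
      (continuous_id.mul continuous_const).tendsto 0
    rw [zero_mul] at this
    exact this.mono_left nhdsWithin_le_nhds
  have := ge_of_tendsto hlim0 (by
    filter_upwards [self_mem_nhdsWithin] with ε hε using key ε hε)
  have := abs_nonpos_iff.1 this
  linarith

/-! ### Hausdorff measure on curves -/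

lemma hausdorffMeasure_image_le_of_norm_sub_le {γ : ℝ → ℂ} {S : Set ℝ} {m : ℝ} (hm : 0 ≤ m)
    (h : ∀ s ∈ S, ∀ t ∈ S, ‖γ s - γ t‖ ≤ m * |s - t|) :
    (Measure.hausdorffMeasure 1 : Measure ℂ) (γ '' S) ≤ ENNReal.ofReal m * volume S := by
  have hL : LipschitzOnWith m.toNNReal γ S := LipschitzOnWith.of_dist_le_mul fun s hs t ht => by
    rw [dist_eq_norm, Real.dist_eq, Real.coe_toNNReal _ hm]
    exact h s hs t ht
  have := hL.hausdorffMeasure_image_le (d := 1) zero_le_one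
  rwa [ENNReal.rpow_one, hausdorffMeasure_real] at this

lemma le_hausdorffMeasure_image_of_le_norm_sub {γ : ℝ → ℂ} {S : Set ℝ} {m : ℝ}
    (h : ∀ s ∈ S, ∀ t ∈ S, m * |s - t| ≤ ‖γ s - γ t‖) :
    ENNReal.ofReal m * volume S ≤ (Measure.hausdorffMeasure 1 : Measure ℂ) (γ '' S) := by
  rcases le_or_gt m 0 with hm | hm
  · simp [ENNReal.ofReal_of_nonpos hm]
  have hinj : Set.InjOn γ S := by
    intro s hs t ht hst
    have := h s hs t ht
    rw [hst, sub_self, norm_zero] at this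
    have h2 : |s - t| ≤ 0 := by
      by_contra hcon
      have := mul_pos hm (not_le.1 hcon)
      linarith
    exact sub_eq_zero.1 (abs_nonpos_iff.1 h2)
  have hgi : Set.LeftInvOn (Function.invFunOn γ S) γ S := hinj.leftInvOn_invFunOn
  have hL : LipschitzOnWith (m⁻¹).toNNReal (Function.invFunOn γ S) (γ '' S) := by
    refine LipschitzOnWith.of_dist_le_mul ?_
    rintro _ ⟨s, hs, rfl⟩ _ ⟨t, ht, rfl⟩
    rw [hgi hs, hgi ht, Real.dist_eq, dist_eq_norm, Real.coe_toNNReal _ (inv_nonneg.2 hm.le),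
      inv_mul_eq_div, le_div_iff₀ hm, mul_comm]
    exact h s hs t ht
  have := hL.hausdorffMeasure_image_le (d := 1) zero_le_one
  rw [ENNReal.rpow_one, hausdorffMeasure_real, hgi.image_image] at this
  calc ENNReal.ofReal m * volume S ≤ ENNReal.ofReal m *
        (ENNReal.ofReal m⁻¹ * (Measure.hausdorffMeasure 1 : Measure ℂ) (γ '' S)) := by
        gcongr
        exact this
    _ = _ := by
      rw [← mul_assoc, ← ENNReal.ofReal_mul hm.le, mul_inv_cancel₀ hm.ne', ENNReal.ofReal_one,
        one_mul]

/-- On a set where the curve is nearly affine, the length of the image and the integral of the speed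
differ by a small multiple of the measure of the set. -/
lemma hausdorffMeasure_image_near {γ γ' : ℝ → ℂ} {S : Set ℝ} (hS : MeasurableSet S) {c : ℂ} {ε : ℝ}
    (hε : 0 ≤ ε) (h : ∀ s ∈ S, ∀ t ∈ S, ‖γ s - γ t - (s - t) • c‖ ≤ ε * |s - t|)
    (h' : ∀ s ∈ S, ‖γ' s - c‖ ≤ ε) :
    (Measure.hausdorffMeasure 1 : Measure ℂ) (γ '' S)
        ≤ (∫⁻ t in S, ENNReal.ofReal ‖γ' t‖) + ENNReal.ofReal (2 * ε) * volume S ∧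
      (∫⁻ t in S, ENNReal.ofReal ‖γ' t‖)
        ≤ (Measure.hausdorffMeasure 1 : Measure ℂ) (γ '' S)
          + ENNReal.ofReal (2 * ε) * volume S := by
  have hsplit : ENNReal.ofReal (‖c‖ + ε) ≤ ENNReal.ofReal (‖c‖ - ε) + ENNReal.ofReal (2 * ε) := by
    rw [show ‖c‖ + ε = (‖c‖ - ε) + 2 * ε by ring]
    exact ENNReal.ofReal_add_le
  have hcn : ∀ s t : ℝ, ‖(s - t) • c‖ = ‖c‖ * |s - t| := fun s t => by
    rw [norm_smul, Real.norm_eq_abs, mul_comm]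
  have hup : (Measure.hausdorffMeasure 1 : Measure ℂ) (γ '' S)
      ≤ ENNReal.ofReal (‖c‖ + ε) * volume S := by
    refine hausdorffMeasure_image_le_of_norm_sub_le (by positivity) fun s hs t ht => ?_
    have h1 := norm_sub_norm_le (γ s - γ t) ((s - t) • c)
    have := h s hs t ht
    rw [hcn] at h1
    linarith
  have hlo : ENNReal.ofReal (‖c‖ - ε) * volume S
      ≤ (Measure.hausdorffMeasure 1 : Measure ℂ) (γ '' S) := by
    refine le_hausdorffMeasure_image_of_le_norm_sub fun s hs t ht => ?_
    have h1 := norm_sub_norm_le ((s - t) • c) (γ s - γ t)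
    have := h s hs t ht
    rw [hcn, norm_sub_rev ((s - t) • c)] at h1
    linarith
  have iup : (∫⁻ t in S, ENNReal.ofReal ‖γ' t‖) ≤ ENNReal.ofReal (‖c‖ + ε) * volume S := by
    rw [← setLIntegral_const]
    refine setLIntegral_mono' hS fun t ht => ENNReal.ofReal_le_ofReal ?_
    have := norm_sub_norm_le (γ' t) c
    linarith [h' t ht]
  have ilo : ENNReal.ofReal (‖c‖ - ε) * volume S ≤ ∫⁻ t in S, ENNReal.ofReal ‖γ' t‖ := by
    rw [← setLIntegral_const]
    refine setLIntegral_mono' hS fun t ht => ENNReal.ofReal_le_ofReal ?_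
    have := norm_sub_norm_le c (γ' t)
    rw [norm_sub_rev] at this
    linarith [h' t ht]
  have hmid : ENNReal.ofReal (‖c‖ + ε) * volume S
      ≤ ENNReal.ofReal (‖c‖ - ε) * volume S + ENNReal.ofReal (2 * ε) * volume S := by
    rw [← add_mul]; gcongr
  exact ⟨hup.trans (hmid.trans (by gcongr)), iup.trans (hmid.trans (by gcongr))⟩

/-- The area formula for an injective curve of class `C^1`. -/
theorem hausdorffMeasure_image_eq_lintegral_norm_deriv {γ γ' : ℝ → ℂ} {a b : ℝ}
    (hγ : ∀ t, HasDerivAt γ (γ' t) t) (hc : Continuous γ') (hinj : Set.InjOn γ (Set.Ioc a b))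
    {S : Set ℝ} (hS : MeasurableSet S) (hSab : S ⊆ Set.Ioc a b) :
    (Measure.hausdorffMeasure 1 : Measure ℂ) (γ '' S) = ∫⁻ t in S, ENNReal.ofReal ‖γ' t‖ := by
  have hγc : Continuous γ := continuous_iff_continuousAt.2 fun t => (hγ t).continuousAt
  have hV : volume S ≠ ⊤ := ((measure_mono hSab).trans_lt measure_Ioc_lt_top).ne
  have key : ∀ ε > 0,
      (Measure.hausdorffMeasure 1 : Measure ℂ) (γ '' S)
        ≤ (∫⁻ t in S, ENNReal.ofReal ‖γ' t‖) + ENNReal.ofReal (2 * ε) * volume S ∧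
      (∫⁻ t in S, ENNReal.ofReal ‖γ' t‖)
        ≤ (Measure.hausdorffMeasure 1 : Measure ℂ) (γ '' S)
          + ENNReal.ofReal (2 * ε) * volume S := by
    intro ε hε
    obtain ⟨δ, hδ, hδε⟩ := Metric.uniformContinuousOn_iff.1
      (isCompact_Icc.uniformContinuousOn_of_continuous hc.continuousOn
        (s := Set.Icc a b)) ε hε
    set J : ℤ → Set ℝ := fun n => Set.Ioc (a + n • (δ / 2)) (a + (n + 1) • (δ / 2)) with hJ
    have hJm : ∀ n, MeasurableSet (S ∩ J n) := fun n => hS.inter measurableSet_Ioc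
    have hJd : Pairwise (Function.onFun Disjoint fun n => S ∩ J n) := fun m n hmn =>
      (Set.pairwise_disjoint_Ioc_add_zsmul a (δ / 2) hmn).mono
        Set.inter_subset_right Set.inter_subset_right
    have hJu : ⋃ n, S ∩ J n = S := by
      rw [← Set.inter_iUnion, hJ, iUnion_Ioc_add_zsmul (by positivity) a, Set.inter_univ]
    have hloc : ∀ n, (Measure.hausdorffMeasure 1 : Measure ℂ) (γ '' (S ∩ J n))
          ≤ (∫⁻ t in S ∩ J n, ENNReal.ofReal ‖γ' t‖)
            + ENNReal.ofReal (2 * ε) * volume (S ∩ J n) ∧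
        (∫⁻ t in S ∩ J n, ENNReal.ofReal ‖γ' t‖)
          ≤ (Measure.hausdorffMeasure 1 : Measure ℂ) (γ '' (S ∩ J n))
            + ENNReal.ofReal (2 * ε) * volume (S ∩ J n) := by
      intro n
      rcases (S ∩ J n).eq_empty_or_nonempty with he | ⟨t₀, ht₀⟩
      · simp [he]
      · have hconv : Convex ℝ (Set.Ioc a b ∩ J n) := (convex_Ioc a b).inter (convex_Ioc _ _)
        have hclose : ∀ t ∈ Set.Ioc a b ∩ J n, ‖γ' t - γ' t₀‖ ≤ ε := by
          intro t ht
          rw [← dist_eq_norm]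
          refine (hδε t (Set.Ioc_subset_Icc_self ht.1) t₀
            (Set.Ioc_subset_Icc_self (hSab ht₀.1)) ?_).le
          have h1 := ht.2
          have h2 := ht₀.2
          simp only [hJ, Set.mem_Ioc, zsmul_eq_mul] at h1 h2
          push_cast at h1 h2
          rw [Real.dist_eq, abs_lt]
          constructor <;> linarith [h1.1, h1.2, h2.1, h2.2]
        have hsub : S ∩ J n ⊆ Set.Ioc a b ∩ J n := Set.inter_subset_inter_left _ hSab
        refine hausdorffMeasure_image_near (hJm n) (c := γ' t₀) hε.le (fun s hs t ht => ?_)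
          fun t ht => hclose t (hsub ht)
        have := hconv.norm_image_sub_le_of_norm_hasDerivWithin_le (𝕜 := ℝ)
          (f := fun t => γ t - t • γ' t₀) (f' := fun t => γ' t - (1 : ℝ) • γ' t₀) (C := ε)
          (fun t _ => ((hγ t).sub ((hasDerivAt_id t).smul_const (γ' t₀))).hasDerivWithinAt)
          (fun t ht => by rw [one_smul]; exact hclose t ht) (hsub ht) (hsub hs)
        rw [Real.norm_eq_abs] at this
        refine le_trans (le_of_eq ?_) this
        congr 1
        rw [sub_smul]; abel
    have e1 : (Measure.hausdorffMeasure 1 : Measure ℂ) (γ '' S)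
        = ∑' n, (Measure.hausdorffMeasure 1 : Measure ℂ) (γ '' (S ∩ J n)) := by
      conv_lhs => rw [← hJu, Set.image_iUnion]
      refine measure_iUnion (fun m n hmn => ?_) fun n =>
        (hJm n).image_of_continuousOn_injOn hγc.continuousOn
          (hinj.mono (Set.inter_subset_left.trans hSab))
      refine Set.disjoint_left.2 ?_
      rintro _ ⟨s, hs, rfl⟩ ⟨t, ht, hts⟩
      have : t = s := hinj (hSab ht.1) (hSab hs.1) hts
      exact Set.disjoint_left.1 (hJd hmn) hs (this ▸ ht)
    have e2 : (∫⁻ t in S, ENNReal.ofReal ‖γ' t‖)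
        = ∑' n, ∫⁻ t in S ∩ J n, ENNReal.ofReal ‖γ' t‖ := by
      conv_lhs => rw [← hJu]
      exact lintegral_iUnion hJm hJd _
    have e3 : ENNReal.ofReal (2 * ε) * volume S
        = ∑' n, ENNReal.ofReal (2 * ε) * volume (S ∩ J n) := by
      conv_lhs => rw [← hJu]
      rw [measure_iUnion hJd hJm, ENNReal.tsum_mul_left]
    rw [e1, e2, e3, ← ENNReal.tsum_add, ← ENNReal.tsum_add]
    exact ⟨ENNReal.tsum_le_tsum fun n => (hloc n).1, ENNReal.tsum_le_tsum fun n => (hloc n).2⟩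
  have hlim : ∀ B : ENNReal, Tendsto (fun ε : ℝ => B + ENNReal.ofReal (2 * ε) * volume S)
      (𝓝[>] 0) (𝓝 B) := by
    intro B
    have h1 : Tendsto (fun ε : ℝ => ENNReal.ofReal (2 * ε)) (𝓝[>] 0) (𝓝 0) := by
      have : Tendsto (fun ε : ℝ => ENNReal.ofReal (2 * ε)) (𝓝 0) (𝓝 (ENNReal.ofReal (2 * 0))) :=
        (ENNReal.continuous_ofReal.comp (continuous_const.mul continuous_id)).tendsto 0
      rw [mul_zero, ENNReal.ofReal_zero] at this
      exact this.mono_left nhdsWithin_le_nhds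
    have h2 := ENNReal.Tendsto.mul_const (b := volume S) h1 (Or.inr hV)
    rw [zero_mul] at h2
    simpa using h2.const_add B
  apply le_antisymm
  · exact ge_of_tendsto (hlim _) (by
      filter_upwards [self_mem_nhdsWithin] with ε hε using (key ε hε).1)
  · exact ge_of_tendsto (hlim _) (by
      filter_upwards [self_mem_nhdsWithin] with ε hε using (key ε hε).2)

theorem hausdorffMeasure_restrict_image_eq_map {γ γ' : ℝ → ℂ} {a b : ℝ}
    (hγ : ∀ t, HasDerivAt γ (γ' t) t) (hc : Continuous γ') (hinj : Set.InjOn γ (Set.Ioc a b)) :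
    (Measure.hausdorffMeasure 1 : Measure ℂ).restrict (γ '' Set.Ioc a b) =
      ((volume.restrict (Set.Ioc a b)).withDensity fun t => ENNReal.ofReal ‖γ' t‖).map γ := by
  have hγc : Continuous γ := continuous_iff_continuousAt.2 fun t => (hγ t).continuousAt
  ext T hT
  have hpre : MeasurableSet (γ ⁻¹' T) := hγc.measurable hT
  rw [Measure.restrict_apply hT, Measure.map_apply hγc.measurable hT, withDensity_apply _ hpre,
    Measure.restrict_restrict hpre, Set.inter_comm T, ← Set.image_inter_preimage,
    hausdorffMeasure_image_eq_lintegral_norm_deriv hγ hc hinj (measurableSet_Ioc.inter hpre)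
      Set.inter_subset_left, Set.inter_comm]

/-! ### The logarithmic integral -/

lemma log_one_add_sq_div_sq_nonneg (k v : ℝ) : 0 ≤ Real.log (1 + k ^ 2 / v ^ 2) :=
  Real.log_nonneg (by have : 0 ≤ k ^ 2 / v ^ 2 := by positivity
                      linarith)

/-- An antiderivative is `v log (1 + k ^ 2 / v ^ 2) + 2 k arctan (v / k)`; it is written below in a
form which is continuous at `0`. -/
lemma integral_Ioi_log_one_add_sq_div_sq {k : ℝ} (hk : 0 < k) :
    IntegrableOn (fun v : ℝ => Real.log (1 + k ^ 2 / v ^ 2)) (Set.Ioi 0) ∧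
      ∫ v in Set.Ioi (0 : ℝ), Real.log (1 + k ^ 2 / v ^ 2) = Real.pi * k := by
  set G : ℝ → ℝ := fun v =>
    v * Real.log (v ^ 2 + k ^ 2) - 2 * (v * Real.log v) + 2 * k * Real.arctan (v / k) with hG
  have hpos : ∀ v : ℝ, v ^ 2 + k ^ 2 ≠ 0 := fun v => by positivity
  have hGc : Continuous G := by
    have h1 : Continuous fun v : ℝ => v * Real.log v := Real.continuous_mul_log
    have h2 : Continuous fun v : ℝ => Real.log (v ^ 2 + k ^ 2) :=
      Continuous.log (by fun_prop) hpos
    have h3 : Continuous fun v : ℝ => Real.arctan (v / k) :=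
      Real.continuous_arctan.comp (continuous_id.div_const k)
    exact ((continuous_id.mul h2).sub (continuous_const.mul h1)).add (continuous_const.mul h3)
  have hlog : ∀ v : ℝ, v ≠ 0 →
      Real.log (1 + k ^ 2 / v ^ 2) = Real.log (v ^ 2 + k ^ 2) - 2 * Real.log v := by
    intro v hv
    rw [show 1 + k ^ 2 / v ^ 2 = (v ^ 2 + k ^ 2) / v ^ 2 by field_simp,
      Real.log_div (hpos v) (pow_ne_zero 2 hv), Real.log_pow]
    norm_num
  have hd : ∀ v ∈ Set.Ioi (0 : ℝ), HasDerivAt G (Real.log (1 + k ^ 2 / v ^ 2)) v := by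
    intro v hv
    have hv0 : v ≠ 0 := (Set.mem_Ioi.1 hv).ne'
    have h1 : HasDerivAt (fun v : ℝ => Real.log (v ^ 2 + k ^ 2)) (2 * v / (v ^ 2 + k ^ 2)) v := by
      have := (((hasDerivAt_id v).pow 2).add_const (k ^ 2)).log (hpos v)
      simpa using this
    have h2 := (hasDerivAt_id v).mul h1
    have h3 := ((hasDerivAt_id v).mul (Real.hasDerivAt_log hv0)).const_mul 2
    have h4 := (((hasDerivAt_id v).div_const k).arctan).const_mul (2 * k)
    refine ((h2.sub h3).add h4).congr_deriv ?_
    rw [hlog v hv0]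
    simp only [id]
    have := hpos v
    have h5 : 1 + (v / k) ^ 2 ≠ 0 := by positivity
    field_simp
    ring
  have hlim : Tendsto G atTop (𝓝 (Real.pi * k)) := by
    have h1 : Tendsto (fun v : ℝ => v * Real.log (1 + k ^ 2 / v ^ 2)) atTop (𝓝 0) := by
      have hb : Tendsto (fun v : ℝ => k ^ 2 / v) atTop (𝓝 0) :=
        tendsto_const_nhds.div_atTop tendsto_id
      refine tendsto_of_tendsto_of_tendsto_of_le_of_le' tendsto_const_nhds hb ?_ ?_
      · filter_upwards [eventually_gt_atTop 0] with v hv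
        exact mul_nonneg hv.le (log_one_add_sq_div_sq_nonneg k v)
      · filter_upwards [eventually_gt_atTop 0] with v hv
        have := Real.log_le_sub_one_of_pos (x := 1 + k ^ 2 / v ^ 2) (by positivity)
        calc v * Real.log (1 + k ^ 2 / v ^ 2) ≤ v * (k ^ 2 / v ^ 2) := by
              gcongr; linarith
          _ = k ^ 2 / v := by field_simp
    have h2 : Tendsto (fun v : ℝ => 2 * k * Real.arctan (v / k)) atTop
        (𝓝 (2 * k * (Real.pi / 2))) :=
      ((Real.tendsto_arctan_atTop.mono_right nhdsWithin_le_nhds).comp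
        (tendsto_id.atTop_div_const hk)).const_mul _
    have h3 := h1.add h2
    rw [show 0 + 2 * k * (Real.pi / 2) = Real.pi * k by ring] at h3
    refine h3.congr' ?_
    filter_upwards [eventually_gt_atTop 0] with v hv
    rw [hlog v hv.ne', hG]
    ring
  have hG0 : G 0 = 0 := by simp [hG]
  refine ⟨integrableOn_Ioi_deriv_of_nonneg hGc.continuousWithinAt hd
    (fun v _ => log_one_add_sq_div_sq_nonneg k v) hlim, ?_⟩
  rw [integral_Ioi_of_hasDerivAt_of_nonneg hGc.continuousWithinAt hd
    (fun v _ => log_one_add_sq_div_sq_nonneg k v) hlim, hG0, sub_zero]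

lemma integral_log_one_add_sq_div_sq {k : ℝ} (hk : 0 < k) :
    Integrable (fun v : ℝ => Real.log (1 + k ^ 2 / v ^ 2)) ∧
      ∫ v : ℝ, Real.log (1 + k ^ 2 / v ^ 2) = 2 * Real.pi * k := by
  obtain ⟨h1, h2⟩ := integral_Ioi_log_one_add_sq_div_sq hk
  have habs : (fun v : ℝ => Real.log (1 + k ^ 2 / v ^ 2))
      = fun v : ℝ => Real.log (1 + k ^ 2 / |v| ^ 2) := by simp
  constructor
  · have h3 : IntegrableOn (fun v : ℝ => Real.log (1 + k ^ 2 / v ^ 2)) (Set.Iic 0) := by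
      have hneg : MeasurableEmbedding fun v : ℝ => -v := (Homeomorph.neg ℝ).measurableEmbedding
      rw [← Measure.map_neg_eq_self (volume : Measure ℝ), hneg.integrableOn_map_iff]
      simpa [Function.comp_def] using Iff.mpr integrableOn_Ici_iff_integrableOn_Ioi h1
    rw [← integrableOn_univ, ← Set.Iic_union_Ioi (a := (0 : ℝ))]
    exact h3.union h1
  · rw [habs, integral_comp_abs (f := fun v => Real.log (1 + k ^ 2 / v ^ 2)), h2]
    ring

lemma image_cot_Ioo : (fun δ : ℝ => Real.cos δ / Real.sin δ) '' Set.Ioo 0 Real.pi = Set.univ := by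
  refine Set.eq_univ_of_forall fun c => ⟨Real.pi / 2 - Real.arctan c, ⟨?_, ?_⟩, ?_⟩
  · linarith [Real.arctan_lt_pi_div_two c]
  · linarith [Real.neg_pi_div_two_lt_arctan c]
  · simp only
    rw [Real.cos_pi_div_two_sub, Real.sin_pi_div_two_sub, ← Real.tan_eq_sin_div_cos,
      Real.tan_arctan]

lemma injOn_cot_Ioo : Set.InjOn (fun δ : ℝ => Real.cos δ / Real.sin δ) (Set.Ioo 0 Real.pi) := by
  intro x hx y hy h
  have hx' := (Real.sin_pos_of_mem_Ioo hx).ne'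
  have hy' := (Real.sin_pos_of_mem_Ioo hy).ne'
  simp only at h
  rw [div_eq_div_iff hx' hy'] at h
  have h0 : Real.sin (x - y) = 0 := by rw [Real.sin_sub]; linarith
  have := (Real.sin_eq_zero_iff_of_lt_of_lt (by linarith [hx.1, hy.2])
    (by linarith [hx.2, hy.1])).1 h0
  linarith

lemma hasDerivAt_cos_div_sin {δ : ℝ} (h : Real.sin δ ≠ 0) :
    HasDerivAt (fun δ : ℝ => Real.cos δ / Real.sin δ) (-(1 / Real.sin δ ^ 2)) δ := by
  refine ((Real.hasDerivAt_cos δ).div (Real.hasDerivAt_sin δ) h).congr_deriv ?_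
  rw [← neg_div]
  congr 1
  nlinarith [Real.sin_sq_add_cos_sq δ]

/-- The substitution of `cot δ`, followed by a translation by `m`. -/
lemma integral_Ioo_log_cot {k : ℝ} (hk : 0 < k) (m : ℝ) :
    IntegrableOn (fun δ => 1 / Real.sin δ ^ 2 *
        Real.log (1 + k ^ 2 / (Real.cos δ / Real.sin δ + m) ^ 2)) (Set.Ioo 0 Real.pi) ∧
      ∫ δ in Set.Ioo 0 Real.pi, 1 / Real.sin δ ^ 2 *
        Real.log (1 + k ^ 2 / (Real.cos δ / Real.sin δ + m) ^ 2) = 2 * Real.pi * k := by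
  obtain ⟨h1, h2⟩ := integral_log_one_add_sq_div_sq hk
  have hd : ∀ δ ∈ Set.Ioo 0 Real.pi, HasDerivWithinAt (fun δ : ℝ => Real.cos δ / Real.sin δ)
      (-(1 / Real.sin δ ^ 2)) (Set.Ioo 0 Real.pi) δ := fun δ hδ =>
    (hasDerivAt_cos_div_sin (Real.sin_pos_of_mem_Ioo hδ).ne').hasDerivWithinAt
  have hab : ∀ δ : ℝ, |-(1 / Real.sin δ ^ 2)| = 1 / Real.sin δ ^ 2 := fun δ => by
    rw [abs_neg, abs_of_nonneg (by positivity)]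
  have e1 := integrableOn_image_iff_integrableOn_abs_deriv_smul measurableSet_Ioo hd injOn_cot_Ioo
    (fun c => Real.log (1 + k ^ 2 / (c + m) ^ 2))
  have e2 := integral_image_eq_integral_abs_deriv_smul measurableSet_Ioo hd injOn_cot_Ioo
    (fun c => Real.log (1 + k ^ 2 / (c + m) ^ 2))
  rw [image_cot_Ioo] at e1 e2
  simp only [hab, smul_eq_mul, integrableOn_univ, Measure.restrict_univ] at e1 e2
  refine ⟨e1.1 (h1.comp_add_right m), ?_⟩
  rw [← e2, ← h2]
  exact integral_add_right_eq_self (fun c => Real.log (1 + k ^ 2 / c ^ 2)) m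

/-- The angle `δ` and the antipodal angle `δ + π` carry the weights `1 / (4 sin² (δ / 2))` and
`1 / (4 cos² (δ / 2))`, with sum `1 / sin² δ`, which is the density of `cot δ`. -/
theorem integral_Ioc_log_cot_div_sin_half_sq {k : ℝ} (hk : 0 < k) (m : ℝ) :
    IntegrableOn (fun δ => 1 / (4 * Real.sin (δ / 2) ^ 2) *
        Real.log (1 + k ^ 2 / (Real.cos δ / Real.sin δ + m) ^ 2)) (Set.Ioc 0 (2 * Real.pi)) ∧
      ∫ δ in Set.Ioc 0 (2 * Real.pi), 1 / (4 * Real.sin (δ / 2) ^ 2) *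
        Real.log (1 + k ^ 2 / (Real.cos δ / Real.sin δ + m) ^ 2) = 2 * Real.pi * k := by
  obtain ⟨h1, h2⟩ := integral_Ioo_log_cot hk m
  set J : ℝ → ℝ := fun δ => Real.log (1 + k ^ 2 / (Real.cos δ / Real.sin δ + m) ^ 2) with hJ
  have hJ0 : ∀ δ, 0 ≤ J δ := fun δ => log_one_add_sq_div_sq_nonneg k _
  have hJm : Measurable J := by
    refine Real.measurable_log.comp ?_
    exact measurable_const.add (measurable_const.div
      (((Real.measurable_cos.div Real.measurable_sin).add_const m).pow_const 2))
  have hJp : ∀ δ, J (δ + Real.pi) = J δ := fun δ => by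
    simp [hJ, Real.cos_add_pi, Real.sin_add_pi, neg_div_neg_eq]
  set S : ℝ → ℝ := fun δ => 1 / (4 * Real.sin (δ / 2) ^ 2) * J δ with hS
  set C : ℝ → ℝ := fun δ => 1 / (4 * Real.cos (δ / 2) ^ 2) * J δ with hC
  have hsm : Measurable S := (measurable_const.div (measurable_const.mul
    ((Real.measurable_sin.comp (measurable_id.div_const 2)).pow_const 2))).mul hJm
  have hcm : Measurable C := (measurable_const.div (measurable_const.mul
    ((Real.measurable_cos.comp (measurable_id.div_const 2)).pow_const 2))).mul hJm
  have hS0 : ∀ δ, 0 ≤ S δ := fun δ => mul_nonneg (by positivity) (hJ0 δ)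
  have hC0 : ∀ δ, 0 ≤ C δ := fun δ => mul_nonneg (by positivity) (hJ0 δ)
  have hsum : ∀ δ ∈ Set.Ioo 0 Real.pi, 1 / Real.sin δ ^ 2 * J δ = S δ + C δ := by
    intro δ hδ
    have hs : Real.sin (δ / 2) ≠ 0 :=
      (Real.sin_pos_of_pos_of_lt_pi (by linarith [hδ.1]) (by linarith [hδ.1, hδ.2])).ne'
    have hc : Real.cos (δ / 2) ≠ 0 :=
      (Real.cos_pos_of_mem_Ioo ⟨by linarith [hδ.1, Real.pi_pos], by linarith [hδ.2]⟩).ne'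
    have e : Real.sin δ = 2 * Real.sin (δ / 2) * Real.cos (δ / 2) := by
      rw [← Real.sin_two_mul]; ring_nf
    rw [e, hS, hC]
    simp only
    rw [← add_mul]
    congr 1
    have := Real.sin_sq_add_cos_sq (δ / 2)
    field_simp
    linarith
  have iS : IntegrableOn S (Set.Ioo 0 Real.pi) := by
    refine Integrable.mono' h1 hsm.aestronglyMeasurable ?_
    filter_upwards [ae_restrict_mem measurableSet_Ioo] with δ hδ
    rw [Real.norm_eq_abs, abs_of_nonneg (hS0 δ), hsum δ hδ]
    linarith [hC0 δ]
  have iC : IntegrableOn C (Set.Ioo 0 Real.pi) := by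
    refine Integrable.mono' h1 hcm.aestronglyMeasurable ?_
    filter_upwards [ae_restrict_mem measurableSet_Ioo] with δ hδ
    rw [Real.norm_eq_abs, abs_of_nonneg (hC0 δ), hsum δ hδ]
    linarith [hS0 δ]
  have hSC : ∀ δ, S (δ + Real.pi) = C δ := fun δ => by
    simp only [hS, hC, hJp]
    rw [show (δ + Real.pi) / 2 = δ / 2 + Real.pi / 2 by ring, Real.sin_add_pi_div_two]
  have iS' : IntervalIntegrable S volume 0 Real.pi := by
    rw [intervalIntegrable_iff_integrableOn_Ioc_of_le Real.pi_pos.le,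
      integrableOn_Ioc_iff_integrableOn_Ioo]
    exact iS
  have iC' : IntervalIntegrable C volume 0 Real.pi := by
    rw [intervalIntegrable_iff_integrableOn_Ioc_of_le Real.pi_pos.le,
      integrableOn_Ioc_iff_integrableOn_Ioo]
    exact iC
  have hSC' : (fun δ => C (δ - Real.pi)) = S := by
    ext δ
    rw [← hSC, sub_add_cancel]
  have iS'' : IntervalIntegrable S volume Real.pi (2 * Real.pi) := by
    have := iC'.comp_sub_right Real.pi
    rw [hSC', zero_add, ← two_mul] at this
    exact this
  have h2π : (0 : ℝ) ≤ 2 * Real.pi := by positivity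
  refine ⟨(intervalIntegrable_iff_integrableOn_Ioc_of_le h2π).1 (iS'.trans iS''), ?_⟩
  have e : ∫ δ in Real.pi..(2 * Real.pi), S δ = ∫ δ in (0 : ℝ)..Real.pi, C δ := by
    rw [← intervalIntegral.integral_congr (fun δ _ => hSC δ),
      intervalIntegral.integral_comp_add_right, zero_add, ← two_mul]
  rw [← intervalIntegral.integral_of_le h2π,
    ← intervalIntegral.integral_add_adjacent_intervals iS' iS'', e,
    ← intervalIntegral.integral_add iS' iC', intervalIntegral.integral_of_le Real.pi_pos.le,
    integral_Ioc_eq_integral_Ioo, ← h2]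
  exact setIntegral_congr_fun measurableSet_Ioo fun δ hδ => (hsum δ hδ).symm

/-! ### Uniqueness of normal and curvature -/

namespace IsBoundaryChart

variable {D : Set ℂ} {x n n' : ℂ} {ψ ψ' : ℝ → ℝ}

lemma continuousAt (h : IsBoundaryChart D x n ψ) : ContinuousAt ψ 0 := h.contDiffAt.continuousAt

lemma hasDerivAt (h : IsBoundaryChart D x n ψ) : HasDerivAt ψ 0 0 := by
  have := (h.contDiffAt.differentiableAt (by norm_num)).hasDerivAt
  rwa [h.deriv_zero] at this

/-- A segment which leaves `x` transversally to the tangent line starts in `D` or outside `D`,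
according to the side of the tangent line. -/
lemma eventually_mem_iff (h : IsBoundaryChart D x n ψ) {a b : ℝ} (hb : b ≠ 0) :
    ∀ᶠ ε : ℝ in 𝓝[>] 0,
      (x + (ε : ℂ) * ((a : ℂ) * (-Complex.I * n) + (b : ℂ) * n) ∈ D ↔ 0 < b) := by
  obtain ⟨r, hr, hmem⟩ := h.mem_iff
  have hscale : HasDerivAt (fun ε : ℝ => ψ (ε * a)) (0 * a) 0 := by
    have h1 : HasDerivAt (fun ε : ℝ => ε * a) a 0 := by
      simpa using (hasDerivAt_id (0 : ℝ)).mul_const a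
    exact HasDerivAt.comp (h₂ := ψ) (h := fun ε : ℝ => ε * a) (0 : ℝ)
      (by simpa using h.hasDerivAt) h1
  have hslope : ∀ᶠ ε : ℝ in 𝓝[>] 0, |ψ (ε * a) / ε| < |b| := by
    have h2 := hscale.tendsto_slope_zero_right
    simp only [zero_add, zero_mul, h.map_zero, sub_zero, smul_eq_mul] at h2
    have h3 := h2.abs
    rw [abs_zero] at h3
    filter_upwards [h3.eventually (gt_mem_nhds (abs_pos.2 hb))] with ε hε
    rwa [div_eq_inv_mul]
  have hsmall : ∀ c : ℝ, ∀ᶠ ε : ℝ in 𝓝[>] 0, |ε * c| < r := by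
    intro c
    have : Tendsto (fun ε : ℝ => |ε * c|) (𝓝 0) (𝓝 |0 * c|) :=
      ((continuous_id.mul continuous_const).abs).tendsto 0
    rw [zero_mul, abs_zero] at this
    exact (this.mono_left nhdsWithin_le_nhds).eventually (gt_mem_nhds hr)
  filter_upwards [hslope, hsmall a, hsmall b, self_mem_nhdsWithin] with ε h1 h2 h3 hε
  have hε' : (0 : ℝ) < ε := hε
  have := hmem (ε * a) (ε * b) h2 h3
  push_cast at this
  rw [show x + (ε : ℂ) * ((a : ℂ) * (-Complex.I * n) + (b : ℂ) * n)
    = x + ((ε : ℂ) * a * (-Complex.I * n) + (ε : ℂ) * b * n) by ring, this]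
  rw [abs_div, abs_of_pos hε', div_lt_iff₀ hε'] at h1
  constructor
  · intro h4
    by_contra hcon
    have hb' : b < 0 := lt_of_le_of_ne (not_lt.1 hcon) hb
    rw [abs_of_neg hb'] at h1
    have := (abs_lt.1 h1).1
    nlinarith
  · intro h4
    rw [abs_of_pos h4] at h1
    have := (abs_lt.1 h1).2
    linarith

lemma eventually_mem_iff_re (h : IsBoundaryChart D x n ψ) {v : ℂ}
    (hv : (v * (starRingEnd ℂ) n).re ≠ 0) :
    ∀ᶠ ε : ℝ in 𝓝[>] 0, (x + (ε : ℂ) * v ∈ D ↔ 0 < (v * (starRingEnd ℂ) n).re) := by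
  have hn : n * (starRingEnd ℂ) n = 1 := by
    rw [Complex.mul_conj, Complex.normSq_eq_norm_sq, h.norm_eq]; simp
  have hdec : v = ((-(v * (starRingEnd ℂ) n).im : ℝ) : ℂ) * (-Complex.I * n)
      + (((v * (starRingEnd ℂ) n).re : ℝ) : ℂ) * n := by
    have : v = (v * (starRingEnd ℂ) n) * n := by rw [mul_assoc, mul_comm _ n, hn, mul_one]
    conv_lhs => rw [this, ← Complex.re_add_im (v * (starRingEnd ℂ) n)]
    push_cast
    ring
  have := h.eventually_mem_iff (a := -(v * (starRingEnd ℂ) n).im) hv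
  rwa [← hdec] at this

/-- The inward normal is unique: otherwise `n - n'` would point to both sides of the boundary. -/
theorem normal_unique (h : IsBoundaryChart D x n ψ) (h' : IsBoundaryChart D x n' ψ') : n = n' := by
  by_contra hne
  have e1 : ((n - n') * (starRingEnd ℂ) n).re = ‖n - n'‖ ^ 2 / 2 := by
    have h1 := h.norm_eq
    have h2 := h'.norm_eq
    rw [← Complex.normSq_eq_norm_sq, Complex.normSq_sub, Complex.normSq_eq_norm_sq,
      Complex.normSq_eq_norm_sq, h1, h2]
    rw [sub_mul, Complex.sub_re, Complex.mul_conj, Complex.normSq_eq_norm_sq, h1]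
    simp
    ring
  have e2 : ((n - n') * (starRingEnd ℂ) n').re = -(‖n - n'‖ ^ 2 / 2) := by
    have h1 := h.norm_eq
    have h2 := h'.norm_eq
    rw [← Complex.normSq_eq_norm_sq, Complex.normSq_sub, Complex.normSq_eq_norm_sq,
      Complex.normSq_eq_norm_sq, h1, h2]
    rw [sub_mul, Complex.sub_re, Complex.mul_conj, Complex.normSq_eq_norm_sq, h2]
    simp
    ring
  have hpos : 0 < ‖n - n'‖ ^ 2 / 2 := by
    have := norm_pos_iff.2 (sub_ne_zero.2 hne)
    positivity
  have h1 := h.eventually_mem_iff_re (v := n - n') (by rw [e1]; exact hpos.ne')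
  have h2 := h'.eventually_mem_iff_re (v := n - n') (by rw [e2]; linarith)
  obtain ⟨ε, h3, h4⟩ := (h1.and h2).exists
  rw [h3, e1, e2] at h4
  have := h4.1 hpos
  linarith

/-- The graph function of a chart is determined near `0` by the domain and the normal. -/
theorem eventuallyEq (h : IsBoundaryChart D x n ψ) (h' : IsBoundaryChart D x n ψ') :
    ψ =ᶠ[𝓝 0] ψ' := by
  obtain ⟨r, hr, hm⟩ := h.mem_iff
  obtain ⟨r', hr', hm'⟩ := h'.mem_iff
  have t0 : ∀ᶠ s : ℝ in 𝓝 0, |s| < min r r' := by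
    have : Tendsto (fun s : ℝ => |s|) (𝓝 0) (𝓝 |0|) := continuous_abs.tendsto 0
    rw [abs_zero] at this
    exact this.eventually (gt_mem_nhds (lt_min hr hr'))
  have t1 : ∀ᶠ s : ℝ in 𝓝 0, |ψ s| < min r r' := by
    have := h.continuousAt.tendsto.abs
    rw [h.map_zero, abs_zero] at this
    exact this.eventually (gt_mem_nhds (lt_min hr hr'))
  have t2 : ∀ᶠ s : ℝ in 𝓝 0, |ψ' s| < min r r' := by
    have := h'.continuousAt.tendsto.abs
    rw [h'.map_zero, abs_zero] at this
    exact this.eventually (gt_mem_nhds (lt_min hr hr'))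
  filter_upwards [t0, t1, t2] with s h0 h1 h2
  rw [lt_min_iff] at h0 h1 h2
  have a1 := (hm s (ψ' s) h0.1 h2.1).symm.trans (hm' s (ψ' s) h0.2 h2.2)
  have a2 := (hm s (ψ s) h0.1 h1.1).symm.trans (hm' s (ψ s) h0.2 h1.2)
  simp only [lt_irrefl, iff_false, false_iff, not_lt] at a1 a2
  exact le_antisymm a2 a1

end IsBoundaryChart

theorem IsBoundaryCurvature.unique {D : Set ℂ} {x : ℂ} {κ κ' : ℝ} (h : IsBoundaryCurvature D x κ)
    (h' : IsBoundaryCurvature D x κ') : κ = κ' := by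
  obtain ⟨n, ψ, hc, hO⟩ := h
  obtain ⟨n', ψ', hc', hO'⟩ := h'
  obtain rfl := hc.normal_unique hc'
  have heq := hc.eventuallyEq hc'
  have h1 : (fun s : ℝ => (1 / 2 * (κ' - κ)) * s ^ 2) =O[𝓝 0] fun s : ℝ => s ^ 3 := by
    refine (hO.sub hO').congr' ?_ EventuallyEq.rfl
    filter_upwards [heq] with s hs
    rw [hs]; ring
  have h2 : (fun s : ℝ => s ^ 3) =o[𝓝 0] fun s : ℝ => s ^ 2 :=
    isLittleO_pow_pow (by norm_num)
  have h3 := (h1.trans_isLittleO h2)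
  by_contra hne
  have hne' : 1 / 2 * (κ' - κ) ≠ 0 := mul_ne_zero (by norm_num) (sub_ne_zero.2 (Ne.symm hne))
  have h4 : (fun s : ℝ => s ^ 2) =o[𝓝 (0 : ℝ)] fun s : ℝ => s ^ 2 :=
    (isLittleO_const_mul_left_iff hne').1 h3
  rw [isLittleO_iff] at h4
  have h5 := (h4 (c := 1 / 2) (by norm_num)).filter_mono (nhdsWithin_le_nhds (s := Set.Ioi 0))
  obtain ⟨s, hs, hs0⟩ := (h5.and self_mem_nhdsWithin).exists
  have hs0' : (0 : ℝ) < s := hs0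
  rw [Real.norm_of_nonneg (by positivity)] at hs
  nlinarith [pow_pos hs0' 2]

/-! ### Geometry of the ellipse -/

/-- If `D` is given near `x` by a quadratic inequality whose linear part is a positive multiple of
the normal coordinate, then the boundary is a graph: the graph of the root of the quadratic
polynomial, `ψ s = -2 a s ^ 2 / (G + √(G ^ 2 - 4 a d s ^ 2))` with `G = g + 2 b s`. This form of
the root does not need `d ≠ 0`, and shows the curvature `-2 a / g`. -/
theorem exists_isBoundaryChart_of_quadratic {D : Set ℂ} {x n : ℂ} (hn : ‖n‖ = 1) {g a b d : ℝ}
    (hg : 0 < g) (hD : ∀ s t : ℝ, x + ((s : ℂ) * (-Complex.I * n) + (t : ℂ) * n) ∈ D ↔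
      0 < g * t + a * s ^ 2 + 2 * b * s * t + d * t ^ 2) :
    ∃ ψ : ℝ → ℝ, IsBoundaryChart D x n ψ ∧
      (fun s : ℝ => ψ s - (1 / 2) * (-2 * a / g) * s ^ 2) =O[𝓝 0] (fun s : ℝ => s ^ 3) := by
  set disc : ℝ → ℝ := fun s => (g + 2 * b * s) ^ 2 - 4 * a * d * s ^ 2 with hdisc
  set H : ℝ → ℝ := fun s => (g + 2 * b * s) + √(disc s) with hH
  have hdisc0 : disc 0 = g ^ 2 := by simp [hdisc]
  have hH0 : H 0 = 2 * g := by
    simp only [hH, hdisc0, Real.sqrt_sq hg.le]; ring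
  have hdc : ContDiff ℝ 4 disc := by fun_prop
  have hHc : ContDiffAt ℝ 4 H 0 := by
    refine ContDiffAt.add (by fun_prop) (hdc.contDiffAt.sqrt ?_)
    rw [hdisc0]; positivity
  have hH0' : H 0 ≠ 0 := by rw [hH0]; positivity
  set k : ℝ → ℝ := fun s => -2 * a / H s with hk
  have hkc : ContDiffAt ℝ 4 k 0 := contDiffAt_const.div hHc hH0'
  have hkd : HasDerivAt k (deriv k 0) 0 := (hkc.differentiableAt (by norm_num)).hasDerivAt
  have hk0 : k 0 = -a / g := by
    simp only [hk, hH0]; field_simp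
  set ψ : ℝ → ℝ := fun s => s ^ 2 * k s with hψ
  have hψd : HasDerivAt ψ 0 0 := by
    refine (((hasDerivAt_id (0 : ℝ)).pow 2).mul hkd).congr_deriv ?_
    simp
  refine ⟨ψ, ⟨hn, (contDiffAt_id.pow 2).mul hkc, by simp [hψ], hψd.deriv, ?_⟩, ?_⟩
  · have e1 : ∀ᶠ y : ℝ × ℝ in 𝓝 0, 0 < disc y.1 := by
      have : ContinuousAt (fun y : ℝ × ℝ => disc y.1) 0 :=
        (hdc.continuous.comp continuous_fst).continuousAt
      refine this.eventually (lt_mem_nhds ?_)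
      simp only [Prod.fst_zero, hdisc0]; positivity
    have e2 : ∀ᶠ y : ℝ × ℝ in 𝓝 0, 0 < H y.1 := by
      have : ContinuousAt (fun y : ℝ × ℝ => H y.1) 0 :=
        ContinuousAt.comp (g := H) (f := Prod.fst) hHc.continuousAt continuous_fst.continuousAt
      refine this.eventually (lt_mem_nhds ?_)
      simp only [Prod.fst_zero, hH0]; positivity
    have e3 : ∀ᶠ y : ℝ × ℝ in 𝓝 0, 0 < d * y.2 + H y.1 / 2 := by
      have : ContinuousAt (fun y : ℝ × ℝ => d * y.2 + H y.1 / 2) 0 := by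
        refine ContinuousAt.add (by fun_prop) (ContinuousAt.div_const ?_ 2)
        exact ContinuousAt.comp (g := H) (f := Prod.fst) hHc.continuousAt
          continuous_fst.continuousAt
      refine this.eventually (lt_mem_nhds ?_)
      simp only [Prod.fst_zero, Prod.snd_zero, hH0]; linarith
    obtain ⟨r, hr, hball⟩ := Metric.eventually_nhds_iff.1 (e1.and (e2.and e3))
    refine ⟨r, hr, fun s t hs ht => ?_⟩
    obtain ⟨h1, h2, h3⟩ := hball (y := (s, t)) (by
      rw [dist_zero_right, Prod.norm_def]
      exact max_lt hs ht)
    simp only at h1 h2 h3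
    have hfac : g * t + a * s ^ 2 + 2 * b * s * t + d * t ^ 2
        = (t - ψ s) * (d * t + H s / 2) := by
      have hsq : (H s - (g + 2 * b * s)) ^ 2 = disc s := by
        simp only [hH]
        rw [add_sub_cancel_left, Real.sq_sqrt h1.le]
      have hne : H s ≠ 0 := h2.ne'
      simp only [hψ, hk]
      simp only [hdisc] at hsq
      field_simp
      linear_combination (-t) * hsq
    rw [hD, hfac]
    constructor
    · intro h
      have := (pos_iff_pos_of_mul_pos h).2 h3
      linarith
    · intro h
      exact mul_pos (by linarith) h3
  · have h1 : (fun s => k s - k 0) =O[𝓝 0] fun s : ℝ => s := by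
      simpa using hkd.isBigO_sub
    have h2 := (isBigO_refl (fun s : ℝ => s ^ 2) (𝓝 0)).mul h1
    refine h2.congr (fun s => ?_) fun s => by ring
    simp only [hψ, hk0]
    ring

namespace Ellipse

/-- The quadratic form of the ellipse: the squared gauge of the centred ellipse. -/
def form (c u : ℂ) (p q : ℝ) (z : ℂ) : ℝ :=
  (((z - c) * (starRingEnd ℂ) u).re / p) ^ 2 + (((z - c) * (starRingEnd ℂ) u).im / q) ^ 2

/-- The boundary of the ellipse, parametrized by the eccentric angle. -/
def curve (c u : ℂ) (p q θ : ℝ) : ℂ :=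
  c + u * ((p * Real.cos θ : ℝ) + (q * Real.sin θ : ℝ) * Complex.I)

/-- The derivative of `Ellipse.curve`. -/
def velocity (u : ℂ) (p q θ : ℝ) : ℂ :=
  u * ((-p * Real.sin θ : ℝ) + (q * Real.cos θ : ℝ) * Complex.I)

/-- The speed of `Ellipse.curve`. -/
def speed (p q θ : ℝ) : ℝ := √(p ^ 2 * Real.sin θ ^ 2 + q ^ 2 * Real.cos θ ^ 2)

/-- The unit normal along `Ellipse.curve`, pointing to the exterior of the ellipse. -/
def normal (u : ℂ) (p q θ : ℝ) : ℂ :=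
  u * ((q * Real.cos θ / speed p q θ : ℝ) + (p * Real.sin θ / speed p q θ : ℝ) * Complex.I)

variable {c u : ℂ} {p q : ℝ}

lemma mul_conj_eq_one (hu : ‖u‖ = 1) : u * (starRingEnd ℂ) u = 1 := by
  rw [Complex.mul_conj, Complex.normSq_eq_norm_sq, hu]; simp

lemma continuous_form : Continuous (form c u p q) := by
  unfold form
  fun_prop

lemma isOpen_ellipseExterior : IsOpen (ellipseExterior c u p q) :=
  isOpen_lt continuous_const continuous_form

lemma mem_ellipseExterior {z : ℂ} : z ∈ ellipseExterior c u p q ↔ 1 < form c u p q z := Iff.rfl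

lemma speed_sq (θ : ℝ) :
    speed p q θ ^ 2 = p ^ 2 * Real.sin θ ^ 2 + q ^ 2 * Real.cos θ ^ 2 :=
  Real.sq_sqrt (by positivity)

lemma speed_pos (hp : 0 < p) (hq : 0 < q) (θ : ℝ) : 0 < speed p q θ := by
  refine Real.sqrt_pos.2 ?_
  have h := Real.sin_sq_add_cos_sq θ
  rcases eq_or_ne (Real.sin θ) 0 with h0 | h0
  · have : Real.cos θ ^ 2 = 1 := by rw [h0] at h; linarith
    rw [this]; positivity
  · positivity

lemma continuous_speed : Continuous (speed p q) := by
  unfold speed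
  fun_prop

lemma form_add (hu : ‖u‖ = 1) (x y : ℝ) :
    form c u p q (c + u * (x + y * Complex.I)) = (x / p) ^ 2 + (y / q) ^ 2 := by
  have : (c + u * (x + y * Complex.I) - c) * (starRingEnd ℂ) u = x + y * Complex.I := by
    rw [add_sub_cancel_left, mul_comm u, mul_assoc, mul_conj_eq_one hu, mul_one]
  rw [form, this]
  simp

lemma hasDerivAt_curve (θ : ℝ) : HasDerivAt (curve c u p q) (velocity u p q θ) θ := by
  have h1 := ((Real.hasDerivAt_cos θ).const_mul p).ofReal_comp
  have h2 := (((Real.hasDerivAt_sin θ).const_mul q).ofReal_comp).mul_const Complex.I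
  refine (((h1.add h2).const_mul u).const_add c).congr_deriv ?_
  simp [velocity]

lemma continuous_curve : Continuous (curve c u p q) :=
  continuous_iff_continuousAt.2 fun θ => (hasDerivAt_curve θ).continuousAt

lemma continuous_velocity : Continuous (velocity u p q) := by
  unfold velocity
  fun_prop

lemma norm_ofReal_add_ofReal_mul_I (hu : ‖u‖ = 1) (x y : ℝ) :
    ‖u * ((x : ℂ) + (y : ℂ) * Complex.I)‖ = √(x ^ 2 + y ^ 2) := by
  rw [norm_mul, hu, one_mul, Complex.norm_add_mul_I]

lemma norm_velocity (hu : ‖u‖ = 1) (θ : ℝ) : ‖velocity u p q θ‖ = speed p q θ := by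
  rw [velocity, norm_ofReal_add_ofReal_mul_I hu, speed]
  congr 1
  ring

lemma norm_normal (hu : ‖u‖ = 1) (hp : 0 < p) (hq : 0 < q) (θ : ℝ) : ‖normal u p q θ‖ = 1 := by
  rw [normal, norm_ofReal_add_ofReal_mul_I hu, Real.sqrt_eq_one, div_pow, div_pow, ← add_div,
    div_eq_one_iff_eq (pow_ne_zero 2 (speed_pos hp hq θ).ne'), speed_sq]
  ring

lemma curve_periodic : Function.Periodic (curve c u p q) (2 * Real.pi) := fun θ => by
  simp [curve]

lemma injOn_curve (hu : ‖u‖ = 1) (hp : 0 < p) (hq : 0 < q) (a : ℝ) :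
    Set.InjOn (curve c u p q) (Set.Ioc a (a + 2 * Real.pi)) := by
  intro s hs t ht h
  have hu0 : u ≠ 0 := by rintro rfl; simp at hu
  have h1 := mul_left_cancel₀ hu0 (add_left_cancel h)
  have hre := congrArg Complex.re h1
  have him := congrArg Complex.im h1
  simp [-Complex.ofReal_cos, -Complex.ofReal_sin, hp.ne', hq.ne'] at hre him
  have hcos : Real.cos (s - t) = 1 := by
    rw [Real.cos_sub, hre, him]
    nlinarith [Real.sin_sq_add_cos_sq t]
  have := (Real.cos_eq_one_iff_of_lt_of_lt (by linarith [hs.1, ht.2]) (by linarith [hs.2, ht.1])).1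
    hcos
  linarith

lemma injOn_curve_add (hu : ‖u‖ = 1) (hp : 0 < p) (hq : 0 < q) (φ : ℝ) :
    Set.InjOn (fun δ => curve c u p q (φ + δ)) (Set.Ioc 0 (2 * Real.pi)) := by
  intro s hs t ht h
  exact add_left_cancel (injOn_curve hu hp hq φ ⟨by linarith [hs.1], by linarith [hs.2]⟩
    ⟨by linarith [ht.1], by linarith [ht.2]⟩ h)

lemma form_curve (hu : ‖u‖ = 1) (hp : 0 < p) (hq : 0 < q) (θ : ℝ) :
    form c u p q (curve c u p q θ) = 1 := by
  rw [curve, form_add hu, mul_div_cancel_left₀ _ hp.ne', mul_div_cancel_left₀ _ hq.ne',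
    Real.cos_sq_add_sin_sq]

lemma exists_curve_eq (hu : ‖u‖ = 1) (hp : 0 < p) (hq : 0 < q) {z : ℂ}
    (hz : form c u p q z = 1) : ∃ θ, curve c u p q θ = z := by
  set ζ := (z - c) * (starRingEnd ℂ) u with hζ
  have hzζ : z = c + u * ζ := by
    rw [hζ, mul_comm (z - c), ← mul_assoc, mul_conj_eq_one hu]; ring
  set v : ℂ := ((ζ.re / p : ℝ) : ℂ) + ((ζ.im / q : ℝ) : ℂ) * Complex.I with hv
  have hnv : ‖v‖ = 1 := by
    rw [hv, Complex.norm_add_mul_I]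
    exact Real.sqrt_eq_one.2 hz
  have hv0 : v ≠ 0 := by rw [← norm_pos_iff, hnv]; exact one_pos
  refine ⟨v.arg, ?_⟩
  rw [curve, Complex.cos_arg hv0, Complex.sin_arg, hnv, hzζ]
  congr 2
  rw [← Complex.re_add_im ζ]
  congr 3 <;> simp [hv] <;> field_simp

lemma frontier_ellipseExterior :
    frontier (ellipseExterior c u p q) = {z | form c u p q z = 1} := by
  apply Set.Subset.antisymm
  · intro z hz
    exact (frontier_lt_subset_eq continuous_const continuous_form hz).symm
  · intro z hz
    have hz' : form c u p q z = 1 := hz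
    rw [isOpen_ellipseExterior.frontier_eq]
    refine ⟨?_, fun h => ?_⟩
    · have hscale : ∀ t : ℝ, form c u p q (c + t * (z - c)) = t ^ 2 := by
        intro t
        have : (c + t * (z - c) - c) * (starRingEnd ℂ) u
            = t * ((z - c) * (starRingEnd ℂ) u) := by ring
        rw [← mul_one (t ^ 2), ← hz', form, this, Complex.re_ofReal_mul,
          Complex.im_ofReal_mul, form]
        ring
      have hT : Tendsto (fun t : ℝ => c + (t : ℂ) * (z - c)) (𝓝[>] 1) (𝓝 z) := by
        have : Tendsto (fun t : ℝ => c + (t : ℂ) * (z - c)) (𝓝 1)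
            (𝓝 (c + ((1 : ℝ) : ℂ) * (z - c))) :=
          (Continuous.tendsto (by fun_prop) 1)
        rw [Complex.ofReal_one, one_mul, add_sub_cancel] at this
        exact this.mono_left nhdsWithin_le_nhds
      refine mem_closure_of_tendsto hT ?_
      filter_upwards [self_mem_nhdsWithin] with t ht
      have ht' : (1 : ℝ) < t := ht
      rw [mem_ellipseExterior, hscale]
      nlinarith
    · exact absurd hz' (ne_of_gt h)

lemma frontier_eq_range (hu : ‖u‖ = 1) (hp : 0 < p) (hq : 0 < q) :
    frontier (ellipseExterior c u p q) = Set.range (curve c u p q) := by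
  rw [frontier_ellipseExterior]
  ext z
  exact ⟨fun hz => exists_curve_eq hu hp hq hz, by rintro ⟨θ, rfl⟩; exact form_curve hu hp hq θ⟩

/-- Arc length on the ellipse in terms of the eccentric angle, counted from any base angle. -/
lemma arcLength_eq_map (hu : ‖u‖ = 1) (hp : 0 < p) (hq : 0 < q) (φ : ℝ) :
    arcLength (ellipseExterior c u p q) =
      ((volume.withDensity fun δ => ENNReal.ofReal (speed p q (φ + δ))).restrict
        (Set.Ioc 0 (2 * Real.pi))).map (fun δ => curve c u p q (φ + δ)) := by
  have hd : ∀ δ : ℝ, HasDerivAt (fun δ => curve c u p q (φ + δ)) (velocity u p q (φ + δ)) δ :=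
    fun δ => (hasDerivAt_curve (φ + δ)).comp_const_add φ δ
  have h := hausdorffMeasure_restrict_image_eq_map hd
    (continuous_velocity.comp (continuous_const.add continuous_id)) (injOn_curve_add hu hp hq φ)
  rw [show (fun δ => curve c u p q (φ + δ)) '' Set.Ioc 0 (2 * Real.pi)
      = Set.range (curve c u p q) by
    rw [← curve_periodic.image_Ioc (by positivity) φ,
      ← Set.image_image (curve c u p q) (fun δ => φ + δ),
      Set.image_const_add_Ioc, add_zero]] at h
  rw [arcLength, frontier_eq_range hu hp hq, h, restrict_withDensity measurableSet_Ioc]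
  simp only [norm_velocity hu]

/-- The exterior of the ellipse has a boundary chart at every boundary point, with curvature
`-p q / L ^ 3`: the boundary bends away from the outward normal. -/
lemma exists_chart (hu : ‖u‖ = 1) (hp : 0 < p) (hq : 0 < q) (θ : ℝ) :
    ∃ ψ : ℝ → ℝ, IsBoundaryChart (ellipseExterior c u p q) (curve c u p q θ) (normal u p q θ) ψ ∧
      (fun s : ℝ => ψ s - (1 / 2) * (-(p * q) / speed p q θ ^ 3) * s ^ 2)
        =O[𝓝 0] (fun s : ℝ => s ^ 3) := by
  have hL := speed_pos hp hq θ
  have hL2 := speed_sq (p := p) (q := q) θ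
  set L := speed p q θ with hLdef
  set C := Real.cos θ with hC
  set S := Real.sin θ with hS
  have hCS : S ^ 2 + C ^ 2 = 1 := Real.sin_sq_add_cos_sq θ
  obtain ⟨ψ, h1, h2⟩ := exists_isBoundaryChart_of_quadratic
    (D := ellipseExterior c u p q) (x := curve c u p q θ) (norm_normal hu hp hq θ)
    (g := 2 * L / (p * q)) (a := 1 / L ^ 2) (b := (q / p - p / q) * C * S / L ^ 2)
    (d := ((q * C / (p * L)) ^ 2 + (p * S / (q * L)) ^ 2)) (by positivity) (fun s t => by
      have e : curve c u p q θ + ((s : ℂ) * (-Complex.I * normal u p q θ)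
          + (t : ℂ) * normal u p q θ) = c + u * (((p * C + (s * (p * S) + t * (q * C)) / L : ℝ) : ℂ)
          + ((q * S + (-(s * (q * C)) + t * (p * S)) / L : ℝ) : ℂ) * Complex.I) := by
        have hL' : (L : ℂ) ≠ 0 := by exact_mod_cast hL.ne'
        rw [curve, normal, ← hLdef, ← hC, ← hS]
        push_cast
        field_simp
        linear_combination (-(u * s * p * S)) * Complex.I_sq
      rw [mem_ellipseExterior, e, form_add hu, ← sub_pos]
      have : ((p * C + (s * (p * S) + t * (q * C)) / L) / p) ^ 2
          + ((q * S + (-(s * (q * C)) + t * (p * S)) / L) / q) ^ 2 - 1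
          = 2 * L / (p * q) * t + 1 / L ^ 2 * s ^ 2
            + 2 * ((q / p - p / q) * C * S / L ^ 2) * s * t
            + ((q * C / (p * L)) ^ 2 + (p * S / (q * L)) ^ 2) * t ^ 2 := by
        field_simp
        linear_combination (-2 * p * q * t * L) * hL2 + q ^ 2 * p ^ 2 * (L ^ 2 + s ^ 2) * hCS
      rw [this])
  refine ⟨ψ, h1, ?_⟩
  have hκ : -2 * (1 / L ^ 2) / (2 * L / (p * q)) = -(p * q) / L ^ 3 := by field_simp
  rwa [hκ] at h2

end Ellipse

/-! ### The conformal map onto the exterior of the ellipse -/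

namespace Ellipse

/-- The conformal map `w ↦ c + u (A / w + B w)`, `A = (p + q) / 2`, `B = (p - q) / 2`, of the
punctured unit disc onto the exterior of the ellipse; it sends `0` to infinity. -/
def joukowski (c u : ℂ) (p q : ℝ) (w : ℂ) : ℂ :=
  c + u * (((p + q) / 2 : ℝ) / w + ((p - q) / 2 : ℝ) * w)

/-- The punctured closed unit disc. -/
def puncturedDisc : Set ℂ := {w | w ≠ 0 ∧ ‖w‖ ≤ 1}

/-- The inverse of `Ellipse.joukowski` on the closed exterior of the ellipse, with values in the
punctured closed unit disc. -/
def joukowskiInv (c u : ℂ) (p q : ℝ) (z : ℂ) : ℂ :=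
  Function.invFunOn (joukowski c u p q) puncturedDisc z

variable {c u : ℂ} {p q : ℝ}

lemma joukowski_sub {w w' : ℂ} (hw : w ≠ 0) (hw' : w' ≠ 0) :
    joukowski c u p q w - joukowski c u p q w' =
      (w - w') * (u * (((p - q) / 2 : ℝ) - ((p + q) / 2 : ℝ) / (w * w'))) := by
  simp only [joukowski]
  field_simp
  ring

/-- The lower bound `min p q = A - |B|` for the dilatation of the conformal map. -/
lemma min_le_norm_quotient (hu : ‖u‖ = 1) (hp : 0 < p) (hq : 0 < q) {w w' : ℂ}
    (hw : w ∈ puncturedDisc) (hw' : w' ∈ puncturedDisc) :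
    min p q ≤ ‖u * (((p - q) / 2 : ℝ) - ((p + q) / 2 : ℝ) / (w * w'))‖ := by
  have h1 : 0 < ‖w * w'‖ := norm_pos_iff.2 (mul_ne_zero hw.1 hw'.1)
  have h2 : ‖w * w'‖ ≤ 1 := by
    rw [norm_mul]
    exact mul_le_one₀ hw.2 (norm_nonneg _) hw'.2
  rw [norm_mul, hu, one_mul, norm_sub_rev]
  refine le_trans ?_ (norm_sub_norm_le _ _)
  rw [norm_div, Complex.norm_real, Complex.norm_real, Real.norm_eq_abs, Real.norm_eq_abs,
    abs_of_pos (by positivity)]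
  have h3 : (p + q) / 2 ≤ (p + q) / 2 / ‖w * w'‖ := by
    rw [le_div_iff₀ h1]
    have : 0 < (p + q) / 2 := by positivity
    nlinarith
  have h4 : min p q = (p + q) / 2 - |(p - q) / 2| := by
    rcases le_total p q with h | h
    · rw [min_eq_left h, abs_of_nonpos (by linarith)]; ring
    · rw [min_eq_right h, abs_of_nonneg (by linarith)]; ring
  linarith

lemma min_mul_norm_sub_le (hu : ‖u‖ = 1) (hp : 0 < p) (hq : 0 < q) {w w' : ℂ}
    (hw : w ∈ puncturedDisc) (hw' : w' ∈ puncturedDisc) :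
    min p q * ‖w - w'‖ ≤ ‖joukowski c u p q w - joukowski c u p q w'‖ := by
  rw [joukowski_sub hw.1 hw'.1, norm_mul, mul_comm]
  exact mul_le_mul_of_nonneg_left (min_le_norm_quotient hu hp hq hw hw') (norm_nonneg _)

lemma injOn_joukowski (hu : ‖u‖ = 1) (hp : 0 < p) (hq : 0 < q) :
    Set.InjOn (joukowski c u p q) puncturedDisc := by
  intro w hw w' hw' h
  have := min_mul_norm_sub_le (c := c) hu hp hq hw hw'
  rw [h, sub_self, norm_zero] at this
  have hm : 0 < min p q := lt_min hp hq
  have : ‖w - w'‖ ≤ 0 := by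
    by_contra hcon
    have := mul_pos hm (not_le.1 hcon)
    linarith
  exact sub_eq_zero.1 (norm_le_zero_iff.1 this)

lemma form_joukowski (hu : ‖u‖ = 1) (hp : 0 < p) (hq : 0 < q) {w : ℂ} (hw : w ≠ 0) :
    form c u p q (joukowski c u p q w) - 1 =
      (1 - ‖w‖ ^ 2) * (((p + q) / 2) ^ 2 / ‖w‖ ^ 2 - ((p - q) / 2) ^ 2) *
        (((w.re / p) ^ 2 + (w.im / q) ^ 2) / ‖w‖ ^ 2) := by
  have hN : 0 < ‖w‖ ^ 2 := by have := norm_pos_iff.2 hw; positivity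
  have hNe : ‖w‖ ^ 2 = w.re ^ 2 + w.im ^ 2 := by
    rw [← Complex.normSq_eq_norm_sq, Complex.normSq_apply]; ring
  have e : joukowski c u p q w = c + u * (((((p + q) / 2) / ‖w‖ ^ 2 + (p - q) / 2) * w.re : ℝ)
      + (((p - q) / 2 - ((p + q) / 2) / ‖w‖ ^ 2) * w.im : ℝ) * Complex.I) := by
    rw [joukowski, div_eq_mul_inv, Complex.inv_def, Complex.normSq_eq_norm_sq,
      div_eq_mul_inv ((p + q) / 2)]
    generalize (‖w‖ ^ 2)⁻¹ = r
    congr 2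
    apply Complex.ext <;> simp <;> ring
  rw [e, form_add hu]
  rw [hNe] at hN ⊢
  field_simp
  ring

lemma form_joukowski_factor_pos (hp : 0 < p) (hq : 0 < q) {w : ℂ} (hw : w ≠ 0) :
    0 < ((w.re / p) ^ 2 + (w.im / q) ^ 2) / ‖w‖ ^ 2 := by
  have := norm_pos_iff.2 hw
  refine div_pos ?_ (by positivity)
  by_cases h : w.re = 0
  · have h2 : w.im ≠ 0 := fun h' => hw (Complex.ext h h')
    positivity
  · positivity

lemma form_joukowski_factor_pos' (hp : 0 < p) (hq : 0 < q) {w : ℂ} (hw : w ≠ 0)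
    (h : |(p - q) / 2| * ‖w‖ ^ 2 ≤ (p + q) / 2) :
    0 < ((p + q) / 2) ^ 2 / ‖w‖ ^ 2 - ((p - q) / 2) ^ 2 := by
  have hN : 0 < ‖w‖ ^ 2 := by have := norm_pos_iff.2 hw; positivity
  have hB : |(p - q) / 2| < (p + q) / 2 := by rw [abs_lt]; constructor <;> linarith
  rw [sub_pos, lt_div_iff₀ hN, ← sq_abs ((p - q) / 2)]
  calc |(p - q) / 2| ^ 2 * ‖w‖ ^ 2 = |(p - q) / 2| * (|(p - q) / 2| * ‖w‖ ^ 2) := by ring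
    _ ≤ |(p - q) / 2| * ((p + q) / 2) := by gcongr
    _ < (p + q) / 2 * ((p + q) / 2) := by gcongr
    _ = _ := by ring

lemma abs_mul_norm_sq_le (hp : 0 < p) (hq : 0 < q) {w : ℂ} (hw : ‖w‖ ≤ 1) :
    |(p - q) / 2| * ‖w‖ ^ 2 ≤ (p + q) / 2 := by
  have hB : |(p - q) / 2| < (p + q) / 2 := by rw [abs_lt]; constructor <;> linarith
  have h1 : ‖w‖ ^ 2 ≤ 1 := by nlinarith [norm_nonneg w]
  nlinarith [abs_nonneg ((p - q) / 2)]

lemma one_le_form_joukowski_iff (hu : ‖u‖ = 1) (hp : 0 < p) (hq : 0 < q) {w : ℂ} (hw : w ≠ 0)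
    (h : |(p - q) / 2| * ‖w‖ ^ 2 ≤ (p + q) / 2) :
    1 ≤ form c u p q (joukowski c u p q w) ↔ ‖w‖ ≤ 1 := by
  rw [← sub_nonneg, form_joukowski hu hp hq hw,
    mul_nonneg_iff_of_pos_right (form_joukowski_factor_pos hp hq hw),
    mul_nonneg_iff_of_pos_right (form_joukowski_factor_pos' hp hq hw h), sub_nonneg,
    sq_le_one_iff₀ (norm_nonneg _)]

lemma joukowski_mem_iff (hu : ‖u‖ = 1) (hp : 0 < p) (hq : 0 < q) {w : ℂ} (hw : w ∈ puncturedDisc) :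
    joukowski c u p q w ∈ ellipseExterior c u p q ↔ ‖w‖ < 1 := by
  rw [mem_ellipseExterior, ← sub_pos, form_joukowski hu hp hq hw.1,
    mul_pos_iff_of_pos_right (form_joukowski_factor_pos hp hq hw.1),
    mul_pos_iff_of_pos_right (form_joukowski_factor_pos' hp hq hw.1
      (abs_mul_norm_sq_le hp hq hw.2)), sub_pos, sq_lt_one_iff₀ (norm_nonneg _)]

/-- Of the two preimages of a point under the rational function, with product `A / B`, the one of
smaller modulus is the right one. -/
lemma exists_joukowski_eq (hu : ‖u‖ = 1) (hp : 0 < p) (hq : 0 < q) {z : ℂ}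
    (hz : 1 ≤ form c u p q z) : ∃ w ∈ puncturedDisc, joukowski c u p q w = z := by
  have hu0 : u ≠ 0 := by rintro rfl; simp at hu
  set A : ℝ := (p + q) / 2 with hA
  set B : ℝ := (p - q) / 2 with hB
  have hA0 : 0 < A := by positivity
  have hAc : (A : ℂ) ≠ 0 := by exact_mod_cast hA0.ne'
  set ζ := (z - c) / u with hζ
  have hzζ : z = c + u * ζ := by rw [hζ]; field_simp; ring
  suffices h : ∃ w : ℂ, w ≠ 0 ∧ |B| * ‖w‖ ^ 2 ≤ A ∧ (A : ℂ) / w + B * w = ζ by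
    obtain ⟨w, hw0, hwB, hw⟩ := h
    have hJ : joukowski c u p q w = z := by rw [joukowski, ← hA, ← hB, hw, hzζ]
    refine ⟨w, ⟨hw0, ?_⟩, hJ⟩
    rw [← one_le_form_joukowski_iff hu hp hq hw0 hwB, hJ]
    exact hz
  rcases eq_or_ne B 0 with hB0 | hB0
  · have hζ0 : ζ ≠ 0 := by
      intro h0
      rw [hzζ, h0] at hz
      norm_num [form] at hz
    refine ⟨A / ζ, div_ne_zero hAc hζ0, by simp [hB0, hA0.le], ?_⟩
    rw [hB0]
    field_simp
    simp
  · have hBc : (B : ℂ) ≠ 0 := by exact_mod_cast hB0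
    obtain ⟨s, hs⟩ : ∃ s : ℂ, discrim (B : ℂ) (-ζ) A = s * s := by
      obtain ⟨s, hs⟩ := IsAlgClosed.exists_pow_nat_eq (discrim (B : ℂ) (-ζ) A) (n := 2)
        (by norm_num)
      exact ⟨s, by rw [← hs]; ring⟩
    obtain ⟨w, hw⟩ : ∃ w : ℂ, B * (w * w) + -ζ * w + A = 0 :=
      exists_quadratic_eq_zero hBc ⟨s, hs⟩
    have hw0 : w ≠ 0 := by
      rintro rfl
      simp at hw
      exact hA0.ne' hw
    have hwe : (A : ℂ) / w + B * w = ζ := by field_simp; linear_combination hw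
    by_cases hle : |B| * ‖w‖ ^ 2 ≤ A
    · exact ⟨w, hw0, hle, hwe⟩
    · refine ⟨A / (B * w), div_ne_zero hAc (mul_ne_zero hBc hw0), ?_, ?_⟩
      · have hwp := norm_pos_iff.2 hw0
        have hBp := abs_pos.2 hB0
        rw [norm_div, norm_mul, Complex.norm_real, Complex.norm_real, Real.norm_eq_abs,
          Real.norm_eq_abs, abs_of_pos hA0]
        rw [show |B| * (A / (|B| * ‖w‖)) ^ 2 = A * (A / (|B| * ‖w‖ ^ 2)) by field_simp]
        have : A / (|B| * ‖w‖ ^ 2) ≤ 1 := by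
          rw [div_le_one (by positivity)]
          exact (not_le.1 hle).le
        nlinarith
      · rw [← hwe]
        field_simp
        ring

lemma joukowskiInv_spec (hu : ‖u‖ = 1) (hp : 0 < p) (hq : 0 < q) {z : ℂ}
    (hz : 1 ≤ form c u p q z) :
    joukowskiInv c u p q z ∈ puncturedDisc ∧ joukowski c u p q (joukowskiInv c u p q z) = z :=
  Function.invFunOn_pos (exists_joukowski_eq hu hp hq hz)

lemma joukowskiInv_joukowski (hu : ‖u‖ = 1) (hp : 0 < p) (hq : 0 < q) {w : ℂ}
    (hw : w ∈ puncturedDisc) : joukowskiInv c u p q (joukowski c u p q w) = w :=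
  (injOn_joukowski hu hp hq).leftInvOn_invFunOn hw

lemma norm_joukowskiInv_lt_one (hu : ‖u‖ = 1) (hp : 0 < p) (hq : 0 < q) {z : ℂ}
    (hz : z ∈ ellipseExterior c u p q) : ‖joukowskiInv c u p q z‖ < 1 := by
  obtain ⟨h1, h2⟩ := joukowskiInv_spec hu hp hq (le_of_lt hz)
  rw [← joukowski_mem_iff hu hp hq h1, h2]
  exact hz

/-- The inverse of the conformal map is Lipschitz continuous up to the boundary. -/
lemma norm_joukowskiInv_sub_le (hu : ‖u‖ = 1) (hp : 0 < p) (hq : 0 < q) {z z' : ℂ}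
    (hz : 1 ≤ form c u p q z) (hz' : 1 ≤ form c u p q z') :
    min p q * ‖joukowskiInv c u p q z - joukowskiInv c u p q z'‖ ≤ ‖z - z'‖ := by
  obtain ⟨h1, h2⟩ := joukowskiInv_spec hu hp hq hz
  obtain ⟨h1', h2'⟩ := joukowskiInv_spec hu hp hq hz'
  have := min_mul_norm_sub_le (c := c) hu hp hq h1 h1'
  rwa [h2, h2'] at this

lemma continuousOn_joukowskiInv (hu : ‖u‖ = 1) (hp : 0 < p) (hq : 0 < q) :
    ContinuousOn (joukowskiInv c u p q) {z | 1 ≤ form c u p q z} := by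
  have hm : 0 < min p q := lt_min hp hq
  refine (LipschitzOnWith.of_dist_le_mul (K := (min p q)⁻¹.toNNReal)
    fun z hz z' hz' => ?_).continuousOn
  rw [dist_eq_norm, dist_eq_norm, Real.coe_toNNReal _ (inv_nonneg.2 hm.le), inv_mul_eq_div,
    le_div_iff₀ hm, mul_comm]
  exact norm_joukowskiInv_sub_le hu hp hq hz hz'

lemma hasDerivWithinAt_joukowskiInv (hu : ‖u‖ = 1) (hp : 0 < p) (hq : 0 < q) {z : ℂ}
    (hz : 1 ≤ form c u p q z) :
    HasDerivWithinAt (joukowskiInv c u p q)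
      (u * (((p - q) / 2 : ℝ) - ((p + q) / 2 : ℝ) / joukowskiInv c u p q z ^ 2))⁻¹
      {z | 1 ≤ form c u p q z} z := by
  obtain ⟨h1, h2⟩ := joukowskiInv_spec hu hp hq hz
  set g := joukowskiInv c u p q with hg
  have hm : 0 < min p q := lt_min hp hq
  have hne : ∀ z', 1 ≤ form c u p q z' →
      u * (((p - q) / 2 : ℝ) - ((p + q) / 2 : ℝ) / (g z' * g z)) ≠ 0 := by
    intro z' hz'
    have := min_le_norm_quotient hu hp hq (joukowskiInv_spec hu hp hq hz').1 h1
    rw [← norm_pos_iff]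
    exact hm.trans_le this
  rw [hasDerivWithinAt_iff_tendsto_slope]
  have hcont : Tendsto g (𝓝[{z | 1 ≤ form c u p q z} \ {z}] z) (𝓝 (g z)) :=
    (continuousOn_joukowskiInv hu hp hq z hz).mono_left (nhdsWithin_mono _ Set.sdiff_subset)
  have hT : Tendsto (fun z' => (u * (((p - q) / 2 : ℝ) - ((p + q) / 2 : ℝ) / (g z' * g z)))⁻¹)
      (𝓝[{z | 1 ≤ form c u p q z} \ {z}] z)
      (𝓝 (u * (((p - q) / 2 : ℝ) - ((p + q) / 2 : ℝ) / g z ^ 2))⁻¹) := by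
    rw [pow_two]
    refine Tendsto.inv₀ ?_ (hne z hz)
    exact tendsto_const_nhds.mul (tendsto_const_nhds.sub (tendsto_const_nhds.div
      (hcont.mul tendsto_const_nhds) (mul_ne_zero h1.1 h1.1)))
  refine hT.congr' ?_
  filter_upwards [self_mem_nhdsWithin] with z' hz'
  have hz'z : z' ≠ z := hz'.2
  obtain ⟨h1', h2'⟩ := joukowskiInv_spec hu hp hq hz'.1
  have e := joukowski_sub (c := c) (u := u) (p := p) (q := q) h1'.1 h1.1
  rw [h2, h2'] at e
  have hgg : g z' - g z ≠ 0 := by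
    intro h0
    rw [← hg, h0, zero_mul] at e
    exact hz'z (sub_eq_zero.1 e)
  rw [slope_def_field, e, ← hg]
  have := hne z' hz'.1
  field_simp

lemma analyticAt_joukowskiInv (hu : ‖u‖ = 1) (hp : 0 < p) (hq : 0 < q) {z : ℂ}
    (hz : z ∈ ellipseExterior c u p q) : AnalyticAt ℂ (joukowskiInv c u p q) z := by
  refine DifferentiableOn.analyticAt (s := ellipseExterior c u p q) (fun y hy => ?_)
    (isOpen_ellipseExterior.mem_nhds hz)
  have hsub : ellipseExterior c u p q ⊆ {z | 1 ≤ form c u p q z} := fun y hy =>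
    (mem_ellipseExterior.1 hy).le
  exact (hasDerivWithinAt_joukowskiInv hu hp hq (hsub hy)).differentiableWithinAt.mono hsub

lemma joukowski_exp (θ : ℝ) :
    joukowski c u p q (Complex.exp (-(θ * Complex.I))) = curve c u p q θ := by
  have h1 : Complex.exp (θ * Complex.I) = Real.cos θ + Real.sin θ * Complex.I := by
    rw [Complex.exp_mul_I]; simp
  have h2 : Complex.exp (-(θ * Complex.I)) = Real.cos θ - Real.sin θ * Complex.I := by
    rw [← neg_mul, Complex.exp_mul_I]; simp; ring
  rw [joukowski, curve, div_eq_mul_inv, ← Complex.exp_neg, neg_neg, h1, h2]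
  push_cast
  ring

lemma exp_mem_puncturedDisc (θ : ℝ) : Complex.exp (-(θ * Complex.I)) ∈ puncturedDisc := by
  refine ⟨Complex.exp_ne_zero _, ?_⟩
  rw [Complex.norm_exp]; simp

lemma joukowskiInv_curve (hu : ‖u‖ = 1) (hp : 0 < p) (hq : 0 < q) (θ : ℝ) :
    joukowskiInv c u p q (curve c u p q θ) = Complex.exp (-(θ * Complex.I)) := by
  rw [← joukowski_exp, joukowskiInv_joukowski hu hp hq (exp_mem_puncturedDisc θ)]

/-- The derivative of the conformal map at a point of the circle, in terms of the normal. -/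
lemma deriv_joukowski_exp (hp : 0 < p) (hq : 0 < q) (θ : ℝ) :
    u * (((p - q) / 2 : ℝ) - ((p + q) / 2 : ℝ) / Complex.exp (-(θ * Complex.I)) ^ 2)
      = -(Complex.exp (θ * Complex.I) * (speed p q θ * normal u p q θ)) := by
  have h1 : Complex.exp (θ * Complex.I) = Real.cos θ + Real.sin θ * Complex.I := by
    rw [Complex.exp_mul_I]; simp
  have h3 : Complex.exp (-(θ * Complex.I)) = (Complex.exp (θ * Complex.I))⁻¹ := Complex.exp_neg _
  have hL : (speed p q θ : ℂ) ≠ 0 := by exact_mod_cast (speed_pos hp hq θ).ne'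
  have hCS : (Real.sin θ : ℂ) ^ 2 + (Real.cos θ : ℂ) ^ 2 = 1 := by
    exact_mod_cast Real.sin_sq_add_cos_sq θ
  have h4 : (speed p q θ : ℂ) * normal u p q θ
      = u * (q * Real.cos θ + p * Real.sin θ * Complex.I) := by
    rw [normal]
    push_cast [-Complex.ofReal_cos, -Complex.ofReal_sin]
    field_simp
  rw [h3, inv_pow, div_inv_eq_mul, h1, h4]
  push_cast [-Complex.ofReal_cos, -Complex.ofReal_sin]
  linear_combination (-(u * ((p - q) / 2))) * hCS
    + u * ((p - q) / 2) * (Real.sin θ : ℂ) ^ 2 * Complex.I_sq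

end Ellipse

/-! ### Martin kernels of the exterior of the ellipse -/

lemma HarmonicAt.comp_analyticAt {f : ℂ → ℝ} {g : ℂ → ℂ} {z : ℂ} (hf : HarmonicAt f (g z))
    (hg : AnalyticAt ℂ g z) : HarmonicAt (f ∘ g) z := by
  obtain ⟨r, hr, hball⟩ := Metric.eventually_nhds_iff_ball.1 hf.eventually
  obtain ⟨F, hF, hFf⟩ :=
    InnerProductSpace.HarmonicOnNhd.exists_analyticOnNhd_ball_re_eq (f := f) (z := g z) (R := r)
      fun y hy => hball y hy
  have hc : AnalyticAt ℂ (F ∘ g) z := (hF _ (Metric.mem_ball_self hr)).comp hg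
  refine (harmonicAt_congr_nhds ?_).1 hc.harmonicAt_re
  filter_upwards [hg.continuousAt.eventually (Metric.ball_mem_nhds _ hr)] with y hy
  exact hFf hy

namespace Ellipse

variable {c u : ℂ} {p q : ℝ}

lemma curve_mem_frontier (hu : ‖u‖ = 1) (hp : 0 < p) (hq : 0 < q) (θ : ℝ) :
    curve c u p q θ ∈ frontier (ellipseExterior c u p q) := by
  rw [frontier_eq_range hu hp hq]
  exact ⟨θ, rfl⟩

lemma isInwardNormal_normal (hu : ‖u‖ = 1) (hp : 0 < p) (hq : 0 < q) (θ : ℝ) :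
    IsInwardNormal (ellipseExterior c u p q) (curve c u p q θ) (normal u p q θ) := by
  obtain ⟨ψ, h, -⟩ := exists_chart (c := c) hu hp hq θ
  exact ⟨ψ, h⟩

lemma isInwardNormal_iff (hu : ‖u‖ = 1) (hp : 0 < p) (hq : 0 < q) (θ : ℝ) {n : ℂ} :
    IsInwardNormal (ellipseExterior c u p q) (curve c u p q θ) n ↔ n = normal u p q θ := by
  refine ⟨?_, fun h => h ▸ isInwardNormal_normal hu hp hq θ⟩
  rintro ⟨ψ, h⟩
  obtain ⟨ψ', h', -⟩ := exists_chart (c := c) hu hp hq θ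
  exact h.normal_unique h'

lemma inwardNormal_curve (hu : ‖u‖ = 1) (hp : 0 < p) (hq : 0 < q) (θ : ℝ) :
    inwardNormal (ellipseExterior c u p q) (curve c u p q θ) = normal u p q θ :=
  (isInwardNormal_iff hu hp hq θ).1
    (Classical.epsilon_spec ⟨_, isInwardNormal_normal (c := c) hu hp hq θ⟩)

lemma isBoundaryCurvature_curve (hu : ‖u‖ = 1) (hp : 0 < p) (hq : 0 < q) (θ : ℝ) :
    IsBoundaryCurvature (ellipseExterior c u p q) (curve c u p q θ)
      (-(p * q) / speed p q θ ^ 3) := by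
  obtain ⟨ψ, h, hO⟩ := exists_chart (c := c) hu hp hq θ
  exact ⟨_, ψ, h, hO⟩

lemma boundaryCurvature_curve (hu : ‖u‖ = 1) (hp : 0 < p) (hq : 0 < q) (θ : ℝ) :
    boundaryCurvature (ellipseExterior c u p q) (curve c u p q θ)
      = -(p * q) / speed p q θ ^ 3 :=
  (Classical.epsilon_spec (p := IsBoundaryCurvature (ellipseExterior c u p q) (curve c u p q θ))
    ⟨_, isBoundaryCurvature_curve hu hp hq θ⟩).unique (isBoundaryCurvature_curve hu hp hq θ)

/-- The point of the unit circle which corresponds to the boundary point with eccentric angle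
`θ`. -/
def circlePoint (θ : ℝ) : ℂ := Complex.exp (-(θ * Complex.I))

lemma norm_circlePoint (θ : ℝ) : ‖circlePoint θ‖ = 1 := by
  rw [circlePoint, Complex.norm_exp]; simp

lemma circlePoint_ne_zero (θ : ℝ) : circlePoint θ ≠ 0 := Complex.exp_ne_zero _

/-- The modulus of the derivative of the conformal map. -/
def dilatation (u : ℂ) (p q : ℝ) (w : ℂ) : ℝ :=
  ‖u * (((p - q) / 2 : ℝ) - ((p + q) / 2 : ℝ) / w ^ 2)‖

lemma dilatation_circlePoint (hu : ‖u‖ = 1) (hp : 0 < p) (hq : 0 < q) (θ : ℝ) :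
    dilatation u p q (circlePoint θ) = speed p q θ := by
  rw [dilatation, circlePoint, deriv_joukowski_exp hp hq, norm_neg, norm_mul, norm_mul,
    norm_normal hu hp hq, Complex.norm_exp_ofReal_mul_I, Complex.norm_real,
    Real.norm_of_nonneg (speed_pos hp hq θ).le]
  ring

/-- The Martin kernel of the exterior of the ellipse: the Poisson kernel of the disc, transported by
the conformal map. -/
def martinKernel (c u : ℂ) (p q : ℝ) (w₀ z : ℂ) : ℝ :=
  poissonKernel 0 (joukowskiInv c u p q z) w₀

lemma martinKernel_eq {w₀ : ℂ} (hw₀ : ‖w₀‖ = 1) (z : ℂ) :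
    martinKernel c u p q w₀ z =
      (1 - ‖joukowskiInv c u p q z‖ ^ 2) / ‖w₀ - joukowskiInv c u p q z‖ ^ 2 := by
  simp [martinKernel, poissonKernel_def, hw₀]

lemma joukowskiInv_eq_circlePoint (hu : ‖u‖ = 1) (hp : 0 < p) (hq : 0 < q) (θ : ℝ) :
    joukowskiInv c u p q (curve c u p q θ) = circlePoint θ := joukowskiInv_curve hu hp hq θ

lemma circlePoint_ne_of_curve_ne {θ φ : ℝ} (h : curve c u p q θ ≠ curve c u p q φ) :
    circlePoint θ ≠ circlePoint φ := by
  intro h'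
  apply h
  rw [← joukowski_exp, ← joukowski_exp]
  exact congrArg _ h'

/-- Near infinity the preimage in the disc has modulus at most `1 / 2`, which bounds the Poisson
kernel by `4`. -/
theorem isMartinKernel_martinKernel (hu : ‖u‖ = 1) (hp : 0 < p) (hq : 0 < q) (φ : ℝ) :
    IsMartinKernel (ellipseExterior c u p q) (curve c u p q φ)
      (martinKernel c u p q (circlePoint φ)) := by
  have hw₀ := norm_circlePoint φ
  set w₀ := circlePoint φ with hw₀def
  have hne : ∀ z ∈ ellipseExterior c u p q, w₀ - joukowskiInv c u p q z ≠ 0 := by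
    intro z hz h
    have := norm_joukowskiInv_lt_one hu hp hq hz
    rw [← sub_eq_zero.1 h, hw₀] at this
    exact lt_irrefl _ this
  refine ⟨fun z hz => ?_, fun z hz => ?_, ?_, ?_⟩
  · have hg := analyticAt_joukowskiInv hu hp hq hz
    have hA : AnalyticAt ℂ
        (fun z => (w₀ + joukowskiInv c u p q z) / (w₀ - joukowskiInv c u p q z)) z :=
      (analyticAt_const.add hg).div (analyticAt_const.sub hg) (hne z hz)
    have he : (fun z => ((w₀ + joukowskiInv c u p q z) / (w₀ - joukowskiInv c u p q z)).re)
        = martinKernel c u p q w₀ := by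
      ext z
      rw [martinKernel, poissonKernel_eq_re_herglotzRieszKernel, Function.comp_apply,
        herglotzRieszKernel_def, sub_zero, sub_zero]
    rw [← he]
    exact hA.harmonicAt_re
  · rw [martinKernel_eq hw₀]
    have h1 := norm_joukowskiInv_lt_one hu hp hq hz
    have h2 := norm_pos_iff.2 (hne z hz)
    refine div_pos ?_ (by positivity)
    nlinarith [norm_nonneg (joukowskiInv c u p q z)]
  · intro z hz hzx
    rw [frontier_eq_range hu hp hq] at hz
    obtain ⟨θ, rfl⟩ := hz
    have hd : w₀ - joukowskiInv c u p q (curve c u p q θ) ≠ 0 := by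
      rw [joukowskiInv_eq_circlePoint hu hp hq, hw₀def]
      exact sub_ne_zero.2 (circlePoint_ne_of_curve_ne hzx).symm
    have hg : ContinuousWithinAt (joukowskiInv c u p q) (ellipseExterior c u p q)
        (curve c u p q θ) :=
      (continuousOn_joukowskiInv hu hp hq _ (form_curve hu hp hq θ).ge).mono
        fun y hy => (mem_ellipseExterior.1 hy).le
    have hK : ContinuousWithinAt (fun z => (1 - ‖joukowskiInv c u p q z‖ ^ 2) /
        ‖w₀ - joukowskiInv c u p q z‖ ^ 2) (ellipseExterior c u p q) (curve c u p q θ) :=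
      (continuousWithinAt_const.sub (hg.norm.pow 2)).div
        ((continuousWithinAt_const.sub hg).norm.pow 2) (pow_ne_zero 2 (norm_ne_zero_iff.2 hd))
    have h0 := hK.tendsto
    rw [joukowskiInv_eq_circlePoint hu hp hq, norm_circlePoint, one_pow, sub_self, zero_div] at h0
    exact h0.congr fun z => (martinKernel_eq hw₀ z).symm
  · refine ⟨‖c‖ + 2 * (p + q) + 1, 4, fun z hz hzR => ?_⟩
    obtain ⟨h1, h2⟩ := joukowskiInv_spec hu hp hq (mem_ellipseExterior.1 hz).le
    rw [martinKernel_eq hw₀]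
    set w := joukowskiInv c u p q z with hw
    have hwp : 0 < ‖w‖ := norm_pos_iff.2 h1.1
    have hsmall : ‖w‖ < 1 / 2 := by
      by_contra hcon
      rw [not_lt] at hcon
      have hb : ‖z‖ ≤ ‖c‖ + ((p + q) / 2 / ‖w‖ + |(p - q) / 2| * ‖w‖) := by
        rw [← h2, joukowski]
        refine (norm_add_le _ _).trans (add_le_add le_rfl ?_)
        rw [norm_mul, hu, one_mul]
        refine (norm_add_le _ _).trans (le_of_eq ?_)
        rw [norm_div, norm_mul, Complex.norm_real, Complex.norm_real, Real.norm_eq_abs,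
          Real.norm_eq_abs, abs_of_pos (show 0 < (p + q) / 2 by positivity)]
      have hb1 : (p + q) / 2 / ‖w‖ ≤ p + q := by
        rw [div_le_iff₀ hwp]; nlinarith
      have hb2 : |(p - q) / 2| * ‖w‖ ≤ p + q := by
        have : |(p - q) / 2| ≤ p + q := by rw [abs_le]; constructor <;> linarith
        nlinarith [abs_nonneg ((p - q) / 2), h1.2]
      linarith
    have hd : 1 / 2 ≤ ‖w₀ - w‖ := by
      have := norm_sub_norm_le w₀ w
      rw [hw₀] at this
      linarith
    rw [div_le_iff₀ (by positivity)]
    nlinarith [sq_nonneg ‖w‖]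

lemma hasInwardNormalDeriv_martinKernel (hu : ‖u‖ = 1) (hp : 0 < p) (hq : 0 < q) {φ θ : ℝ}
    (hne : curve c u p q θ ≠ curve c u p q φ) :
    HasInwardNormalDeriv (ellipseExterior c u p q) (martinKernel c u p q (circlePoint φ))
      (curve c u p q θ) (2 / speed p q θ / ‖circlePoint φ - circlePoint θ‖ ^ 2) := by
  have hw₀ := norm_circlePoint φ
  have hw₁ := norm_circlePoint θ
  have hg0 := joukowskiInv_eq_circlePoint (c := c) hu hp hq θ
  set w₀ := circlePoint φ with hw₀def
  set w₁ := circlePoint θ with hw₁def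
  have hwne : w₀ - w₁ ≠ 0 := sub_ne_zero.2 (circlePoint_ne_of_curve_ne hne).symm
  set n := normal u p q θ with hn
  have hn1 : ‖n‖ = 1 := norm_normal hu hp hq θ
  have hL := speed_pos hp hq θ
  have hLc : (speed p q θ : ℂ) ≠ 0 := by exact_mod_cast hL.ne'
  set y := curve c u p q θ with hy
  rw [HasInwardNormalDeriv, inwardNormal_curve hu hp hq, ← hn]
  have hin : ∀ᶠ h : ℝ in 𝓝[>] 0, y + (h : ℂ) * n ∈ ellipseExterior c u p q := by
    obtain ⟨ψ, hψ, -⟩ := exists_chart (c := c) hu hp hq θ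
    have e : (n * (starRingEnd ℂ) n).re = 1 := by rw [mul_conj_eq_one hn1]; simp
    have := hψ.eventually_mem_iff_re (v := n) (by rw [e]; exact one_ne_zero)
    filter_upwards [this] with h hh
    exact hh.2 (by rw [e]; exact one_pos)
  -- the path `h ↦ g (y + h n)` in the disc leaves `w₁` with velocity `-w₁ / L`
  have hpath : HasDerivWithinAt (fun h : ℝ => joukowskiInv c u p q (y + (h : ℂ) * n))
      (-w₁ / speed p q θ) (Set.Ioi 0) 0 := by
    have h1 := hasDerivWithinAt_joukowskiInv (c := c) hu hp hq (form_curve (c := c) hu hp hq θ).ge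
    rw [joukowskiInv_curve hu hp hq, deriv_joukowski_exp hp hq, ← hn] at h1
    have h2 : HasDerivAt (fun h : ℝ => y + (h : ℂ) * n) n 0 := by
      have := (((hasDerivAt_id (0 : ℝ)).ofReal_comp).mul_const n).const_add y
      simpa using this
    set s : Set ℝ := {h | y + (h : ℂ) * n ∈ ellipseExterior c u p q} with hs
    have h3 : HasDerivWithinAt (fun h : ℝ => joukowskiInv c u p q (y + (h : ℂ) * n)) _ s 0 :=
      HasFDerivWithinAt.comp_hasDerivWithinAt_of_eq (l := joukowskiInv c u p q) (0 : ℝ)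
        (h1.hasFDerivWithinAt.restrictScalars ℝ) h2.hasDerivWithinAt
        (fun h hh => (mem_ellipseExterior.1 hh).le) (by simp [hy])
    refine (h3.mono_of_mem_nhdsWithin hin).congr_deriv ?_
    have hn0 : n ≠ 0 := by rw [← norm_pos_iff, hn1]; exact one_pos
    have he : Complex.exp (θ * Complex.I) ≠ 0 := Complex.exp_ne_zero _
    have hw : w₁ = (Complex.exp (θ * Complex.I))⁻¹ := Complex.exp_neg _
    simp [hw]
    field_simp
  have hval : joukowskiInv c u p q (y + ((0 : ℝ) : ℂ) * n) = w₁ := by simp [hg0]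
  have hnum : Tendsto (fun h : ℝ => h⁻¹ *
      (1 - ‖joukowskiInv c u p q (y + (h : ℂ) * n)‖ ^ 2)) (𝓝[>] 0) (𝓝 (2 / speed p q θ)) := by
    have h1 := (hpath.norm_sq).const_sub 1
    rw [hasDerivWithinAt_iff_tendsto_slope' (by simp)] at h1
    have e : -(2 * inner ℝ (joukowskiInv c u p q (y + ((0 : ℝ) : ℂ) * n)) (-w₁ / speed p q θ))
        = 2 / speed p q θ := by
      rw [hval, show -w₁ / (speed p q θ : ℂ) = (-(speed p q θ)⁻¹ : ℝ) • w₁ by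
        rw [Complex.real_smul]; push_cast; field_simp, real_inner_smul_right,
        real_inner_self_eq_norm_sq, hw₁]
      field_simp
    rw [e] at h1
    refine h1.congr fun h => ?_
    rw [slope_def_field, hval, hw₁, div_eq_inv_mul]
    simp
  have hden : Tendsto (fun h : ℝ => ‖w₀ - joukowskiInv c u p q (y + (h : ℂ) * n)‖ ^ 2) (𝓝[>] 0)
      (𝓝 (‖w₀ - w₁‖ ^ 2)) := by
    have := hpath.continuousWithinAt.tendsto
    rw [hval] at this
    exact ((tendsto_const_nhds.sub this).norm).pow 2
  have := hnum.div hden (pow_ne_zero 2 (norm_ne_zero_iff.2 hwne))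
  refine this.congr fun h => ?_
  simp only [Pi.div_apply]
  rw [martinKernel_eq hw₀]
  ring

/-- Every Martin kernel of the exterior of the ellipse is a multiple of `Ellipse.martinKernel`:
transported to the punctured disc it extends across the puncture, the image of infinity, and it
vanishes on the circle except at the pole. -/
theorem exists_eq_mul_martinKernel (hu : ‖u‖ = 1) (hp : 0 < p) (hq : 0 < q) (φ : ℝ) {K : ℂ → ℝ}
    (hK : IsMartinKernel (ellipseExterior c u p q) (curve c u p q φ) K) :
    ∃ C : ℝ, ∀ z ∈ ellipseExterior c u p q,
      K z = C * martinKernel c u p q (circlePoint φ) z := by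
  have hdisc : ∀ w ∈ Metric.ball (0 : ℂ) 1 \ {0}, w ∈ puncturedDisc := fun w hw =>
    ⟨hw.2, (by simpa using hw.1 : ‖w‖ < 1).le⟩
  have hmaps : ∀ w ∈ Metric.ball (0 : ℂ) 1 \ {0},
      joukowski c u p q w ∈ ellipseExterior c u p q := fun w hw =>
    (joukowski_mem_iff hu hp hq (hdisc w hw)).2 (by simpa using hw.1)
  have hJ : ∀ w : ℂ, w ≠ 0 → AnalyticAt ℂ (joukowski c u p q) w := fun w hw => by
    unfold joukowski
    fun_prop (disch := exact hw)
  have hharm : HarmonicOnNhd (K ∘ joukowski c u p q) (Metric.ball 0 1 \ {0}) := fun w hw =>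
    HarmonicAt.comp_analyticAt (hK.harmonic _ (hmaps w hw)) (hJ w hw.2)
  obtain ⟨R, M, hRM⟩ := hK.bounded_at_infinity
  obtain ⟨δ, hδ, hδ1, hδR⟩ : ∃ δ : ℝ, 0 < δ ∧ δ ≤ 1 ∧ ∀ w ∈ Metric.ball (0 : ℂ) δ \ {0},
      R ≤ ‖joukowski c u p q w‖ := by
    have hS : 0 < |R| + |(p - q) / 2| + ‖c‖ + 1 := by positivity
    refine ⟨min 1 ((p + q) / 2 / (|R| + |(p - q) / 2| + ‖c‖ + 1)), by positivity,
      min_le_left _ _, fun w hw => ?_⟩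
    have hw0 : 0 < ‖w‖ := norm_pos_iff.2 hw.2
    have hwδ := hw.1
    rw [mem_ball_zero_iff, lt_min_iff] at hwδ
    have h1 : |R| + |(p - q) / 2| + ‖c‖ + 1 ≤ (p + q) / 2 / ‖w‖ := by
      rw [le_div_iff₀ hw0]
      rw [lt_div_iff₀ hS] at hwδ
      linarith [hwδ.2]
    have h2 : (p + q) / 2 / ‖w‖ = ‖u * (((p + q) / 2 : ℝ) / w)‖ := by
      rw [norm_mul, hu, one_mul, norm_div, Complex.norm_real,
        Real.norm_of_nonneg (by positivity)]
    have h3 : ‖u * (((p - q) / 2 : ℝ) * w)‖ ≤ |(p - q) / 2| := by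
      rw [norm_mul, hu, one_mul, norm_mul, Complex.norm_real, Real.norm_eq_abs]
      nlinarith [abs_nonneg ((p - q) / 2), hwδ.1]
    have h4 : u * (((p + q) / 2 : ℝ) / w) =
        joukowski c u p q w - c - u * (((p - q) / 2 : ℝ) * w) := by
      rw [joukowski]; ring
    have h5 : ‖u * (((p + q) / 2 : ℝ) / w)‖
        ≤ ‖joukowski c u p q w‖ + ‖c‖ + ‖u * (((p - q) / 2 : ℝ) * w)‖ := by
      rw [h4]
      exact (norm_sub_le _ _).trans (add_le_add (norm_sub_le _ _) le_rfl)
    linarith [le_abs_self R]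
  obtain ⟨U, hU, hUK⟩ := HarmonicOnNhd.exists_extension_of_bounded hharm hδ hδ1 (M := M)
    fun w hw => by
      have hw' : w ∈ Metric.ball (0 : ℂ) 1 \ {0} := ⟨Metric.ball_subset_ball hδ1 hw.1, hw.2⟩
      rw [Function.comp_apply, abs_of_pos (hK.pos _ (hmaps w hw'))]
      exact hRM _ (hmaps w hw') (hδR w hw)
  have hUpos : ∀ w ∈ Metric.ball (0 : ℂ) 1, 0 ≤ U w := by
    have hpos : ∀ w ∈ Metric.ball (0 : ℂ) 1 \ {0}, 0 ≤ U w := fun w hw => by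
      rw [hUK hw]
      exact (hK.pos _ (hmaps w hw)).le
    intro w hw
    rcases eq_or_ne w 0 with rfl | h0
    · have hc : Tendsto U (𝓝[≠] 0) (𝓝 (U 0)) :=
        ((hU 0 hw).1.continuousAt).tendsto.mono_left nhdsWithin_le_nhds
      refine ge_of_tendsto hc ?_
      filter_upwards [mem_nhdsWithin_of_mem_nhds (Metric.ball_mem_nhds (0 : ℂ) one_pos),
        self_mem_nhdsWithin] with w h1 h2 using hpos w ⟨h1, h2⟩
    · exact hpos w ⟨hw, h0⟩
  have hUlim : ∀ ζ, ‖ζ‖ = 1 → ζ ≠ circlePoint φ →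
      Tendsto U (𝓝[Metric.ball 0 1] ζ) (𝓝 0) := by
    intro ζ hζ hζne
    have hζ0 : ζ ≠ 0 := by rw [← norm_pos_iff, hζ]; exact one_pos
    have hζp : ζ ∈ puncturedDisc := ⟨hζ0, hζ.le⟩
    have hζf : joukowski c u p q ζ ∈ frontier (ellipseExterior c u p q) := by
      rw [frontier_ellipseExterior]
      have := form_joukowski (c := c) hu hp hq hζ0
      rw [hζ] at this
      change form c u p q (joukowski c u p q ζ) = 1
      linarith
    have hx : joukowski c u p q ζ ≠ curve c u p q φ := by
      rw [← joukowski_exp]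
      exact fun h => hζne (injOn_joukowski hu hp hq hζp (exp_mem_puncturedDisc φ) h)
    have hev : ∀ᶠ w in 𝓝[Metric.ball 0 1] ζ, w ∈ Metric.ball (0 : ℂ) 1 \ {0} := by
      filter_upwards [self_mem_nhdsWithin,
        mem_nhdsWithin_of_mem_nhds (isOpen_ne.mem_nhds hζ0)] with w h1 h2 using ⟨h1, h2⟩
    have hT : Tendsto (joukowski c u p q) (𝓝[Metric.ball 0 1] ζ)
        (𝓝[ellipseExterior c u p q] (joukowski c u p q ζ)) :=
      tendsto_nhdsWithin_iff.2 ⟨(hJ ζ hζ0).continuousAt.tendsto.mono_left nhdsWithin_le_nhds,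
        hev.mono hmaps⟩
    refine ((hK.vanish _ hζf hx).comp hT).congr' ?_
    filter_upwards [hev] with w hw using (hUK hw).symm
  refine ⟨U 0, fun z hz => ?_⟩
  obtain ⟨h1, h2⟩ := joukowskiInv_spec hu hp hq (mem_ellipseExterior.1 hz).le
  have h3 : joukowskiInv c u p q z ∈ Metric.ball (0 : ℂ) 1 := by
    simpa using norm_joukowskiInv_lt_one hu hp hq hz
  have h4 := HarmonicOnNhd.eq_poissonKernel_mul hU hUpos (norm_circlePoint φ) hUlim h3
  rw [hUK ⟨h3, h1.1⟩, Function.comp_apply, h2] at h4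
  rw [h4, martinKernel, mul_comm]

end Ellipse

/-! ### The harmonic density and the inner integral -/

lemma map_restrict_eq_map_subtype {γ : ℝ → ℂ} (hγ : Continuous γ) {s : Set ℝ} (hs : MeasurableSet s)
    (μ : Measure ℝ) :
    (μ.restrict s).map γ = (μ.comap Subtype.val).map (fun t : s => γ t) := by
  rw [← map_comap_subtype_coe hs μ, Measure.map_map hγ.measurable measurable_subtype_coe]
  rfl

lemma measurableEmbedding_subtype {γ : ℝ → ℂ} (hγ : Continuous γ) {s : Set ℝ}
    (hs : MeasurableSet s) (hinj : Set.InjOn γ s) : MeasurableEmbedding (fun t : s => γ t) :=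
  hγ.continuousOn.measurableEmbedding hs hinj

/-- Change of variables along an injective curve. Thanks to injectivity, it needs no measurability
of the integrand. -/
lemma integral_map_restrict_of_injOn {γ : ℝ → ℂ} (hγ : Continuous γ) {s : Set ℝ}
    (hs : MeasurableSet s) (hinj : Set.InjOn γ s) (μ : Measure ℝ) (f : ℂ → ℝ) :
    ∫ y, f y ∂((μ.restrict s).map γ) = ∫ t in s, f (γ t) ∂μ := by
  rw [map_restrict_eq_map_subtype hγ hs, (measurableEmbedding_subtype hγ hs hinj).integral_map,
    ← map_comap_subtype_coe hs μ, (MeasurableEmbedding.subtype_coe hs).integral_map]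

lemma integrable_map_restrict_of_injOn {γ : ℝ → ℂ} (hγ : Continuous γ) {s : Set ℝ}
    (hs : MeasurableSet s) (hinj : Set.InjOn γ s) (μ : Measure ℝ) (f : ℂ → ℝ) :
    Integrable f ((μ.restrict s).map γ) ↔ Integrable (fun t => f (γ t)) (μ.restrict s) := by
  rw [map_restrict_eq_map_subtype hγ hs,
    (measurableEmbedding_subtype hγ hs hinj).integrable_map_iff,
    ← map_comap_subtype_coe hs μ, (MeasurableEmbedding.subtype_coe hs).integrable_map_iff]
  rfl

namespace Ellipse

variable {c u : ℂ} {p q : ℝ}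

lemma continuous_curve_add (φ : ℝ) : Continuous fun δ => curve c u p q (φ + δ) :=
  continuous_curve.comp (continuous_const.add continuous_id)

lemma measurable_ofReal_speed_add (φ : ℝ) :
    Measurable fun δ => ENNReal.ofReal (speed p q (φ + δ)) :=
  (continuous_speed.comp (continuous_const.add continuous_id)).measurable.ennreal_ofReal

lemma integral_arcLength (hu : ‖u‖ = 1) (hp : 0 < p) (hq : 0 < q) (φ : ℝ) (f : ℂ → ℝ) :
    ∫ y, f y ∂(arcLength (ellipseExterior c u p q)) =
      ∫ δ in Set.Ioc 0 (2 * Real.pi), speed p q (φ + δ) * f (curve c u p q (φ + δ)) := by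
  rw [arcLength_eq_map hu hp hq φ, integral_map_restrict_of_injOn
    (continuous_curve_add φ) measurableSet_Ioc (injOn_curve_add hu hp hq φ),
    restrict_withDensity measurableSet_Ioc,
    integral_withDensity_eq_integral_toReal_smul (measurable_ofReal_speed_add φ) (by simp)]
  simp [ENNReal.toReal_ofReal (speed_pos hp hq _).le]

lemma integrable_arcLength_iff (hu : ‖u‖ = 1) (hp : 0 < p) (hq : 0 < q) (φ : ℝ) (f : ℂ → ℝ) :
    Integrable f (arcLength (ellipseExterior c u p q)) ↔
      IntegrableOn (fun δ => speed p q (φ + δ) * f (curve c u p q (φ + δ)))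
        (Set.Ioc 0 (2 * Real.pi)) := by
  rw [arcLength_eq_map hu hp hq φ, integrable_map_restrict_of_injOn
    (continuous_curve_add φ) measurableSet_Ioc (injOn_curve_add hu hp hq φ),
    restrict_withDensity measurableSet_Ioc,
    integrable_withDensity_iff_integrable_smul' (measurable_ofReal_speed_add φ) (by simp)]
  simp [ENNReal.toReal_ofReal (speed_pos hp hq _).le, IntegrableOn]

/-- The density of the harmonic measure with base point at eccentric angle `φ`. -/
def density (c u : ℂ) (p q φ : ℝ) (y : ℂ) : ℝ :=
  (Real.pi * speed p q φ * dilatation u p q (joukowskiInv c u p q y) *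
    ‖circlePoint φ - joukowskiInv c u p q y‖ ^ 2)⁻¹

lemma density_curve (hu : ‖u‖ = 1) (hp : 0 < p) (hq : 0 < q) (φ θ : ℝ) :
    density c u p q φ (curve c u p q θ) =
      (Real.pi * speed p q φ * speed p q θ * ‖circlePoint φ - circlePoint θ‖ ^ 2)⁻¹ := by
  rw [density, joukowskiInv_eq_circlePoint hu hp hq, dilatation_circlePoint hu hp hq]

lemma tendsto_density (hu : ‖u‖ = 1) (hp : 0 < p) (hq : 0 < q) (φ : ℝ) :
    Tendsto (fun y => Real.pi * dist (curve c u p q φ) y ^ 2 * density c u p q φ y)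
      (𝓝[frontier (ellipseExterior c u p q) \ {curve c u p q φ}] (curve c u p q φ)) (𝓝 1) := by
  set x := curve c u p q φ with hx
  set F := frontier (ellipseExterior c u p q) with hF
  have hFsub : F ⊆ {z | 1 ≤ form c u p q z} := by
    rw [hF, frontier_ellipseExterior]
    exact fun z hz => ge_of_eq hz
  have hgx := joukowskiInv_eq_circlePoint (c := c) hu hp hq φ
  rw [← hx] at hgx
  have hw₀ := circlePoint_ne_zero φ
  set w₀ := circlePoint φ with hw₀def
  have hL := speed_pos hp hq φ
  have hdil : dilatation u p q w₀ = speed p q φ := dilatation_circlePoint hu hp hq φ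
  have hg : Tendsto (joukowskiInv c u p q) (𝓝[F \ {x}] x) (𝓝 w₀) := by
    rw [← hgx]
    exact (continuousOn_joukowskiInv hu hp hq x (form_curve hu hp hq φ).ge).mono_left
      (nhdsWithin_mono _ (Set.sdiff_subset.trans hFsub))
  have hT : Tendsto (fun w => ‖u * (((p - q) / 2 : ℝ) - ((p + q) / 2 : ℝ) / (w₀ * w))‖ ^ 2 /
      (speed p q φ * dilatation u p q w)) (𝓝 w₀) (𝓝 1) := by
    have hc : ContinuousAt (fun w => ‖u * (((p - q) / 2 : ℝ) - ((p + q) / 2 : ℝ) / (w₀ * w))‖ ^ 2 /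
        (speed p q φ * dilatation u p q w)) w₀ := by
      unfold dilatation
      have h1 : w₀ * w₀ ≠ 0 := mul_ne_zero hw₀ hw₀
      have h2 : speed p q φ * ‖u * (((p - q) / 2 : ℝ) - ((p + q) / 2 : ℝ) / w₀ ^ 2)‖ ≠ 0 := by
        rw [← dilatation, hdil]; positivity
      fun_prop (disch := first | assumption | exact pow_ne_zero 2 hw₀)
    have h1 := hc.tendsto
    have e : ‖u * (((p - q) / 2 : ℝ) - ((p + q) / 2 : ℝ) / (w₀ * w₀))‖ = speed p q φ := by
      rw [← hdil, dilatation, pow_two]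
    rw [e, hdil, pow_two, div_self (by positivity)] at h1
    exact h1
  refine (hT.comp hg).congr' ?_
  filter_upwards [self_mem_nhdsWithin] with y hy
  obtain ⟨h1, h2⟩ := joukowskiInv_spec hu hp hq (hFsub hy.1)
  have hyx : y ≠ x := hy.2
  have hxJ : x = joukowski c u p q w₀ := by rw [hx, hw₀def, circlePoint, joukowski_exp]
  have hne : w₀ - joukowskiInv c u p q y ≠ 0 := by
    intro h
    apply hyx
    rw [← h2, ← sub_eq_zero.1 h, hxJ]
  have hnp := norm_pos_iff.2 hne
  have e : dist x y = ‖w₀ - joukowskiInv c u p q y‖ *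
      ‖u * (((p - q) / 2 : ℝ) - ((p + q) / 2 : ℝ) / (w₀ * joukowskiInv c u p q y))‖ := by
    rw [dist_eq_norm, ← norm_mul, ← joukowski_sub (c := c) hw₀ h1.1, h2, ← hxJ]
  rw [Function.comp_apply, e, density, ← hw₀def]
  have := Real.pi_pos
  field_simp

lemma neBot_nhdsWithin_frontier (hu : ‖u‖ = 1) (hp : 0 < p) (hq : 0 < q) (φ : ℝ) :
    (𝓝[frontier (ellipseExterior c u p q) \ {curve c u p q φ}] (curve c u p q φ)).NeBot := by
  rw [← mem_closure_iff_nhdsWithin_neBot]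
  have hT : Tendsto (fun δ : ℝ => curve c u p q (φ + δ)) (𝓝[>] 0) (𝓝 (curve c u p q φ)) := by
    have : Tendsto (fun δ : ℝ => curve c u p q (φ + δ)) (𝓝 0) (𝓝 (curve c u p q (φ + 0))) :=
      (continuous_curve.comp (continuous_const.add continuous_id)).tendsto 0
    rw [add_zero] at this
    exact this.mono_left nhdsWithin_le_nhds
  refine mem_closure_of_tendsto hT ?_
  have hπ := Real.pi_pos
  filter_upwards [Ioo_mem_nhdsGT hπ] with δ hδ
  refine ⟨curve_mem_frontier hu hp hq _, fun h => ?_⟩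
  have h' : curve c u p q (φ + δ) = curve c u p q φ := h
  rw [← curve_periodic φ] at h'
  have := injOn_curve_add (c := c) hu hp hq φ ⟨hδ.1, by linarith [hδ.2]⟩
    ⟨by linarith, le_rfl⟩ h'
  linarith [hδ.2]

theorem isHarmonicDensity_density (hu : ‖u‖ = 1) (hp : 0 < p) (hq : 0 < q) (φ : ℝ) :
    IsHarmonicDensity (ellipseExterior c u p q) (curve c u p q φ) (density c u p q φ) := by
  refine ⟨⟨_, (2 * Real.pi * speed p q φ)⁻¹, isMartinKernel_martinKernel hu hp hq φ,
    fun y hy hyx => ?_⟩, tendsto_density hu hp hq φ⟩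
  rw [frontier_eq_range hu hp hq] at hy
  obtain ⟨θ, rfl⟩ := hy
  refine ⟨_, hasInwardNormalDeriv_martinKernel hu hp hq hyx, ?_⟩
  rw [density_curve hu hp hq]
  have h1 := speed_pos hp hq φ
  have h2 := speed_pos hp hq θ
  have h3 := norm_pos_iff.2 (sub_ne_zero.2 (circlePoint_ne_of_curve_ne hyx).symm)
  have := Real.pi_pos
  field_simp

/-- The harmonic density is unique: by uniqueness of the Martin kernel it is determined up to a
constant factor, which is fixed by the normalization at the pole. -/
theorem eqOn_density (hu : ‖u‖ = 1) (hp : 0 < p) (hq : 0 < q) (φ : ℝ) {k : ℂ → ℝ}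
    (hk : IsHarmonicDensity (ellipseExterior c u p q) (curve c u p q φ) k) :
    Set.EqOn k (density c u p q φ)
      (frontier (ellipseExterior c u p q) \ {curve c u p q φ}) := by
  obtain ⟨⟨K, a, hK, hd⟩, hlim⟩ := hk
  obtain ⟨C, hC⟩ := exists_eq_mul_martinKernel hu hp hq φ hK
  have hprop : ∀ y ∈ frontier (ellipseExterior c u p q) \ {curve c u p q φ},
      k y = (a * C * (2 * Real.pi * speed p q φ)) * density c u p q φ y := by
    rintro y ⟨hy, hyx⟩
    obtain ⟨d, hKd, hkd⟩ := hd y hy hyx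
    rw [frontier_eq_range hu hp hq] at hy
    obtain ⟨θ, rfl⟩ := hy
    have hyx' : curve c u p q θ ≠ curve c u p q φ := hyx
    have h0 := (hasInwardNormalDeriv_martinKernel hu hp hq hyx').const_mul C
    have hin : ∀ᶠ h : ℝ in 𝓝[>] 0, curve c u p q θ + (h : ℂ) * inwardNormal
        (ellipseExterior c u p q) (curve c u p q θ) ∈ ellipseExterior c u p q := by
      obtain ⟨ψ, hψ, -⟩ := exists_chart (c := c) hu hp hq θ
      have e : (normal u p q θ * (starRingEnd ℂ) (normal u p q θ)).re = 1 := by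
        rw [mul_conj_eq_one (norm_normal hu hp hq θ)]; simp
      rw [inwardNormal_curve hu hp hq]
      have := hψ.eventually_mem_iff_re (v := normal u p q θ) (by rw [e]; exact one_ne_zero)
      filter_upwards [this] with h hh
      exact hh.2 (by rw [e]; exact one_pos)
    have h1 : d = C * (2 / speed p q θ / ‖circlePoint φ - circlePoint θ‖ ^ 2) := by
      refine tendsto_nhds_unique hKd (h0.congr' ?_)
      filter_upwards [hin] with h hh
      rw [hC _ hh, mul_div_assoc]
    rw [hkd, h1, density_curve hu hp hq]
    have h2 := speed_pos hp hq φ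
    have h3 := speed_pos hp hq θ
    have h4 := norm_pos_iff.2 (sub_ne_zero.2 (circlePoint_ne_of_curve_ne hyx').symm)
    have := Real.pi_pos
    field_simp
  set b := a * C * (2 * Real.pi * speed p q φ) with hb
  have hlim' := (tendsto_density (c := c) hu hp hq φ).const_mul b
  have := neBot_nhdsWithin_frontier (c := c) hu hp hq φ
  have hb1 : 1 = b * 1 := by
    refine tendsto_nhds_unique hlim (hlim'.congr' ?_)
    filter_upwards [self_mem_nhdsWithin] with y hy
    rw [hprop y hy]
    ring
  rw [mul_one] at hb1
  intro y hy
  rw [hprop y hy, ← hb1, one_mul]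

lemma harmonicDensity_eqOn (hu : ‖u‖ = 1) (hp : 0 < p) (hq : 0 < q) (φ : ℝ) :
    Set.EqOn (harmonicDensity (ellipseExterior c u p q) (curve c u p q φ)) (density c u p q φ)
      (frontier (ellipseExterior c u p q) \ {curve c u p q φ}) :=
  eqOn_density hu hp hq φ
    (Classical.epsilon_spec ⟨_, isHarmonicDensity_density (c := c) hu hp hq φ⟩)

/-- The cosine of the angle between two tangent lines. -/
lemma cos_tangentAngle_curve (hu : ‖u‖ = 1) (hp : 0 < p) (hq : 0 < q) (φ θ : ℝ) :
    Real.cos (tangentAngle (ellipseExterior c u p q) (curve c u p q φ) (curve c u p q θ)) =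
      |q ^ 2 * Real.cos φ * Real.cos θ + p ^ 2 * Real.sin φ * Real.sin θ| /
        (speed p q φ * speed p q θ) := by
  have h1 := speed_pos hp hq φ
  have h2 := speed_pos hp hq θ
  rw [tangentAngle, inwardNormal_curve hu hp hq, inwardNormal_curve hu hp hq]
  have hle := abs_real_inner_le_norm (Complex.I * normal u p q φ) (Complex.I * normal u p q θ)
  rw [norm_mul, norm_mul, norm_normal hu hp hq, norm_normal hu hp hq, Complex.norm_I] at hle
  rw [Real.cos_arccos (by linarith [abs_nonneg (inner ℝ (Complex.I * normal u p q φ)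
    (Complex.I * normal u p q θ))]) (by linarith)]
  rw [← abs_of_pos (mul_pos h1 h2), ← abs_div]
  congr 1
  rw [Complex.inner, map_mul, Complex.conj_I]
  rw [show Complex.I * normal u p q θ * (-Complex.I * (starRingEnd ℂ) (normal u p q φ))
    = -(Complex.I ^ 2) * ((starRingEnd ℂ) (normal u p q φ) * normal u p q θ) by ring,
    Complex.I_sq, neg_neg, one_mul, normal, normal, map_mul]
  rw [mul_mul_mul_comm, mul_comm ((starRingEnd ℂ) u) u, mul_conj_eq_one hu, one_mul]
  simp [-Complex.ofReal_cos, -Complex.ofReal_sin, -Complex.ofReal_div]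
  field_simp

/-- The identity `cos ^ 2 + sin ^ 2 = 1` for the angle between the normals, multiplied by the
squared speeds: the sine of this angle is `p q sin δ / (L(φ) L(φ + δ))`. -/
lemma speed_sq_mul_speed_sq (φ δ : ℝ) :
    speed p q φ ^ 2 * speed p q (φ + δ) ^ 2 =
      (q ^ 2 * Real.cos φ * Real.cos (φ + δ) + p ^ 2 * Real.sin φ * Real.sin (φ + δ)) ^ 2
        + (p * q * Real.sin δ) ^ 2 := by
  have h : Real.sin δ = Real.sin (φ + δ) * Real.cos φ - Real.cos (φ + δ) * Real.sin φ := by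
    rw [← Real.sin_sub]; ring_nf
  rw [h, speed_sq, speed_sq]
  ring

/-- The tangent of the angle between the tangent lines is `k / (cot δ + m)`, where
`k = p q / L(φ) ^ 2`. -/
lemma abs_log_cos_tangentAngle (hu : ‖u‖ = 1) (hp : 0 < p) (hq : 0 < q) (φ : ℝ) {δ : ℝ}
    (hδ : Real.sin δ ≠ 0) :
    |Real.log (Real.cos (tangentAngle (ellipseExterior c u p q) (curve c u p q φ)
      (curve c u p q (φ + δ))))| =
    1 / 2 * Real.log (1 + (p * q / speed p q φ ^ 2) ^ 2 / (Real.cos δ / Real.sin δ +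
      (p ^ 2 - q ^ 2) * Real.sin φ * Real.cos φ / speed p q φ ^ 2) ^ 2) := by
  have h1 := speed_pos hp hq φ
  have h2 := speed_pos hp hq (φ + δ)
  have hLL := speed_sq_mul_speed_sq (p := p) (q := q) φ δ
  have hN : q ^ 2 * Real.cos φ * Real.cos (φ + δ) + p ^ 2 * Real.sin φ * Real.sin (φ + δ) =
      Real.sin δ * speed p q φ ^ 2 * (Real.cos δ / Real.sin δ +
      (p ^ 2 - q ^ 2) * Real.sin φ * Real.cos φ / speed p q φ ^ 2) := by
    have e : Real.sin δ * speed p q φ ^ 2 * (Real.cos δ / Real.sin δ +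
        (p ^ 2 - q ^ 2) * Real.sin φ * Real.cos φ / speed p q φ ^ 2) =
        speed p q φ ^ 2 * Real.cos δ + (p ^ 2 - q ^ 2) * Real.sin φ * Real.cos φ * Real.sin δ := by
      field_simp
    rw [e, speed_sq, Real.cos_add, Real.sin_add]
    ring
  rw [cos_tangentAngle_curve hu hp hq]
  set N := q ^ 2 * Real.cos φ * Real.cos (φ + δ) + p ^ 2 * Real.sin φ * Real.sin (φ + δ) with hNdef
  set v := Real.cos δ / Real.sin δ +
      (p ^ 2 - q ^ 2) * Real.sin φ * Real.cos φ / speed p q φ ^ 2 with hv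
  set L := speed p q φ
  set L' := speed p q (φ + δ)
  rcases eq_or_ne v 0 with hv0 | hv0
  -- for orthogonal tangent lines both sides are `0`, by `log 0 = 0` and `x / 0 = 0`
  · rw [hN, hv0]
    simp
  have hN0 : N ≠ 0 := by
    rw [hN]
    exact mul_ne_zero (mul_ne_zero hδ (by positivity)) hv0
  have hNp := abs_pos.2 hN0
  have hle : |N| / (L * L') ≤ 1 := by
    rw [div_le_one (by positivity)]
    refine abs_le_of_sq_le_sq ?_ (mul_pos h1 h2).le
    rw [mul_pow, hLL]
    nlinarith [sq_nonneg (p * q * Real.sin δ)]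
  rw [abs_of_nonpos (Real.log_nonpos (by positivity) hle), ← Real.log_inv, inv_div]
  have e : 1 + (p * q / L ^ 2) ^ 2 / v ^ 2 = (L * L' / |N|) ^ 2 := by
    rw [div_pow (L * L'), sq_abs, mul_pow, hLL, hN]
    field_simp
  rw [e, Real.log_pow]
  push_cast
  ring

lemma norm_circlePoint_sub_sq (φ δ : ℝ) :
    ‖circlePoint φ - circlePoint (φ + δ)‖ ^ 2 = 4 * Real.sin (δ / 2) ^ 2 := by
  have h1 : circlePoint φ - circlePoint (φ + δ)
      = circlePoint φ * (1 - circlePoint δ) := by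
    simp only [circlePoint]
    rw [mul_sub, mul_one, ← Complex.exp_add]
    push_cast
    ring_nf
  have h2 : circlePoint δ = (Real.cos δ : ℂ) - Real.sin δ * Complex.I := by
    rw [circlePoint, ← neg_mul, Complex.exp_mul_I]; simp; ring
  have h3 : Real.cos δ = 1 - 2 * Real.sin (δ / 2) ^ 2 := by
    rw [← mul_div_cancel₀ δ (two_ne_zero), Real.cos_two_mul, Real.cos_sq']
    ring_nf
  have h4 := Real.sin_sq_add_cos_sq δ
  rw [h1, norm_mul, norm_circlePoint, one_mul, h2, ← Complex.normSq_eq_norm_sq,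
    Complex.normSq_apply]
  simp [-Complex.ofReal_cos, -Complex.ofReal_sin]
  nlinarith

lemma ae_sin_ne_zero : ∀ᵐ δ : ℝ, Real.sin δ ≠ 0 := by
  have hc : {δ : ℝ | Real.sin δ = 0}.Countable := by
    refine (Set.countable_range fun n : ℤ => (n : ℝ) * Real.pi).mono fun δ hδ => ?_
    obtain ⟨n, hn⟩ := Real.sin_eq_zero_iff.1 hδ
    exact ⟨n, hn⟩
  rw [ae_iff]
  simpa using hc.measure_zero volume

/-- The inner integrand in terms of the eccentric angle. -/
lemma speed_mul_inner_ae_eq (hu : ‖u‖ = 1) (hp : 0 < p) (hq : 0 < q) (φ : ℝ) :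
    (fun δ => speed p q (φ + δ) *
      (|Real.log (Real.cos (tangentAngle (ellipseExterior c u p q) (curve c u p q φ)
        (curve c u p q (φ + δ))))| * harmonicDensity (ellipseExterior c u p q) (curve c u p q φ)
          (curve c u p q (φ + δ)))) =ᵐ[volume.restrict (Set.Ioc 0 (2 * Real.pi))]
    fun δ => (2 * Real.pi * speed p q φ)⁻¹ * (1 / (4 * Real.sin (δ / 2) ^ 2) *
      Real.log (1 + (p * q / speed p q φ ^ 2) ^ 2 / (Real.cos δ / Real.sin δ +
      (p ^ 2 - q ^ 2) * Real.sin φ * Real.cos φ / speed p q φ ^ 2) ^ 2)) := by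
  filter_upwards [ae_restrict_of_ae ae_sin_ne_zero, ae_restrict_mem measurableSet_Ioc] with δ hδ hI
  have hne : curve c u p q (φ + δ) ≠ curve c u p q φ := by
    intro h
    rw [← curve_periodic φ] at h
    have := injOn_curve_add (c := c) hu hp hq φ hI ⟨by linarith [Real.pi_pos], le_rfl⟩ h
    rw [this] at hδ
    simp at hδ
  rw [abs_log_cos_tangentAngle hu hp hq φ hδ,
    harmonicDensity_eqOn hu hp hq φ ⟨curve_mem_frontier hu hp hq _, hne⟩, density_curve hu hp hq,
    norm_circlePoint_sub_sq]
  have h1 := speed_pos hp hq φ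
  have h2 := speed_pos hp hq (φ + δ)
  have := Real.pi_pos
  field_simp

/-- The pointwise form of the theorem: the inner integral is the negative of the curvature. -/
theorem integral_inner (hu : ‖u‖ = 1) (hp : 0 < p) (hq : 0 < q) (φ : ℝ) :
    Integrable (fun y => |Real.log (Real.cos (tangentAngle (ellipseExterior c u p q)
      (curve c u p q φ) y))| * harmonicDensity (ellipseExterior c u p q) (curve c u p q φ) y)
      (arcLength (ellipseExterior c u p q)) ∧
    ∫ y, |Real.log (Real.cos (tangentAngle (ellipseExterior c u p q)
      (curve c u p q φ) y))| * harmonicDensity (ellipseExterior c u p q) (curve c u p q φ) y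
      ∂(arcLength (ellipseExterior c u p q))
      = -boundaryCurvature (ellipseExterior c u p q) (curve c u p q φ) := by
  have hL := speed_pos hp hq φ
  obtain ⟨h1, h2⟩ := integral_Ioc_log_cot_div_sin_half_sq
    (k := p * q / speed p q φ ^ 2) (by positivity)
    ((p ^ 2 - q ^ 2) * Real.sin φ * Real.cos φ / speed p q φ ^ 2)
  have hae := speed_mul_inner_ae_eq (c := c) hu hp hq φ
  constructor
  · rw [integrable_arcLength_iff hu hp hq φ]
    exact (h1.const_mul _).congr hae.symm
  · rw [integral_arcLength hu hp hq φ, integral_congr_ae hae, integral_const_mul, h2,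
      boundaryCurvature_curve hu hp hq]
    have := Real.pi_pos
    field_simp

lemma cos_tangentAngle_ae_ne_zero (hu : ‖u‖ = 1) (hp : 0 < p) (hq : 0 < q) (φ : ℝ) :
    ∀ᵐ y ∂(arcLength (ellipseExterior c u p q)),
      Real.cos (tangentAngle (ellipseExterior c u p q) (curve c u p q φ) y) ≠ 0 := by
  set a := q ^ 2 * Real.cos φ with ha
  set b := p ^ 2 * Real.sin φ with hb
  have hab : a ≠ 0 ∨ b ≠ 0 := by
    by_contra! h
    have h1 : Real.cos φ = 0 := by simpa [ha, hq.ne'] using h.1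
    have h2 : Real.sin φ = 0 := by simpa [hb, hp.ne'] using h.2
    have := Real.sin_sq_add_cos_sq φ
    rw [h1, h2] at this
    norm_num at this
  set Z : Set ℝ := {θ | a * Real.cos θ + b * Real.sin θ = 0} with hZ
  have hZc : Z.Countable := by
    rcases Z.eq_empty_or_nonempty with h | ⟨θ₁, h₁⟩
    · rw [h]; exact Set.countable_empty
    refine (Set.countable_range fun n : ℤ => θ₁ + (n : ℝ) * Real.pi).mono fun θ hθ => ?_
    have e1 : a * Real.cos θ + b * Real.sin θ = 0 := hθ
    have e2 : a * Real.cos θ₁ + b * Real.sin θ₁ = 0 := h₁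
    have hs : Real.sin (θ - θ₁) = 0 := by
      rw [Real.sin_sub]
      rcases hab with h | h
      · refine (mul_eq_zero.1 (?_ : a * _ = 0)).resolve_left h
        linear_combination Real.sin θ * e2 - Real.sin θ₁ * e1
      · refine (mul_eq_zero.1 (?_ : b * _ = 0)).resolve_left h
        linear_combination Real.cos θ₁ * e1 - Real.cos θ * e2
    obtain ⟨n, hn⟩ := Real.sin_eq_zero_iff.1 hs
    exact ⟨n, by simp only; rw [hn]; ring⟩
  rw [arcLength, ae_restrict_iff' isClosed_frontier.measurableSet]
  have := Measure.nullSingletonClass_hausdorff ℂ (d := 1) one_pos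
  have h0 := (hZc.image (curve c u p q)).measure_zero (Measure.hausdorffMeasure 1 : Measure ℂ)
  rw [ae_iff]
  refine measure_mono_null (fun y hy => ?_) h0
  have hy' := Classical.not_imp.1 (show ¬ (_ → _) from hy)
  obtain ⟨hyF, hy0⟩ := hy'
  rw [frontier_eq_range hu hp hq] at hyF
  obtain ⟨θ, rfl⟩ := hyF
  refine ⟨θ, ?_, rfl⟩
  rw [not_not, cos_tangentAngle_curve hu hp hq, div_eq_zero_iff] at hy0
  have hLL := mul_pos (speed_pos hp hq φ) (speed_pos hp hq θ)
  exact abs_eq_zero.1 (hy0.resolve_right hLL.ne')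

lemma integrable_boundaryCurvature (hu : ‖u‖ = 1) (hp : 0 < p) (hq : 0 < q) :
    Integrable (boundaryCurvature (ellipseExterior c u p q))
      (arcLength (ellipseExterior c u p q)) := by
  rw [integrable_arcLength_iff hu hp hq 0]
  simp only [boundaryCurvature_curve hu hp hq]
  have hs : Continuous fun δ => speed p q (0 + δ) :=
    continuous_speed.comp (continuous_const.add continuous_id)
  have : Continuous fun δ => speed p q (0 + δ) * (-(p * q) / speed p q (0 + δ) ^ 3) :=
    hs.mul (continuous_const.div (hs.pow 3) fun δ => (pow_pos (speed_pos hp hq _) 3).ne')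
  exact this.integrableOn_Ioc

lemma inner_integral_ae_eq (hu : ‖u‖ = 1) (hp : 0 < p) (hq : 0 < q) :
    (fun x => ∫ y, |Real.log (Real.cos (tangentAngle (ellipseExterior c u p q) x y))| *
      harmonicDensity (ellipseExterior c u p q) x y ∂(arcLength (ellipseExterior c u p q)))
      =ᵐ[arcLength (ellipseExterior c u p q)]
    fun x => -boundaryCurvature (ellipseExterior c u p q) x := by
  filter_upwards [ae_restrict_mem isClosed_frontier.measurableSet] with x hx
  rw [frontier_eq_range hu hp hq] at hx
  obtain ⟨φ, rfl⟩ := hx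
  exact (integral_inner hu hp hq φ).2

theorem lyapunovWellDefined (hu : ‖u‖ = 1) (hp : 0 < p) (hq : 0 < q) :
    LyapunovWellDefined (ellipseExterior c u p q) := by
  have hparam : ∀ x ∈ frontier (ellipseExterior c u p q), ∃ φ, curve c u p q φ = x := fun x hx => by
    rwa [frontier_eq_range hu hp hq] at hx
  refine ⟨fun x hx => ?_, fun x hx => ?_, fun x hx => ?_, fun x hx => ?_,
    integrable_boundaryCurvature hu hp hq, fun x hx => ?_, fun x hx => ?_,
    (integrable_boundaryCurvature hu hp hq).neg.congr (inner_integral_ae_eq hu hp hq).symm⟩ <;>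
    obtain ⟨φ, rfl⟩ := hparam x hx
  · exact ⟨_, isInwardNormal_normal hu hp hq φ, fun n hn => (isInwardNormal_iff hu hp hq φ).1 hn⟩
  · exact ⟨_, isBoundaryCurvature_curve hu hp hq φ,
      fun κ hκ => hκ.unique (isBoundaryCurvature_curve hu hp hq φ)⟩
  · exact ⟨_, isHarmonicDensity_density hu hp hq φ⟩
  · exact fun k k' hk hk' => (eqOn_density hu hp hq φ hk).trans (eqOn_density hu hp hq φ hk').symm
  · exact cos_tangentAngle_ae_ne_zero hu hp hq φ
  · exact (integral_inner hu hp hq φ).1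

theorem lyapunovExponent_eq_zero (hu : ‖u‖ = 1) (hp : 0 < p) (hq : 0 < q) :
    lyapunovExponent (ellipseExterior c u p q) = 0 := by
  rw [lyapunovExponent, integral_congr_ae (inner_integral_ae_eq hu hp hq), integral_neg,
    add_neg_cancel]

end Ellipse

end

theorem proposition2p4 (c u : ℂ) (p q : ℝ) (hu : ‖u‖ = 1) (hp : 0 < p) (hq : 0 < q) :
    LyapunovWellDefined (ellipseExterior c u p q) ∧
      lyapunovExponent (ellipseExterior c u p q) = 0 :=
  ⟨Ellipse.lyapunovWellDefined hu hp hq, Ellipse.lyapunovExponent_eq_zero hu hp hq⟩
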